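/- Let $F$ be a real Hurwitz algebra, that is, a nonzero finite-dimensional unital (not necessarily associative) real algebra with a positive definite multiplicative quadratic form $N$ (so $F\in\{\mathbb R,\mathbb C,\mathbb H,\mathbb O\}$ up to isomorphism), with its canonical involution $a\mapsto\bar a=(N(a+1)-N(a)-N(1))1-a$. Let $n\ge 1$, and suppose $n=3$ if $F$ is not associative. Let $\mathrm{Herm}(n,F)=\{x\in \mathrm{Mat}(n,F):\bar x^{t}=x\}$ with the Jordan product $x\star y=\tfrac12(xy+yx)$ and multiplication operators $L_\star(x)y=x\star y$. Equip it with $$\hat h(x,y)=n^{-1}\operatorname{tr}(x\star y)=(\dim_{\mathbb R} \mathrm{Herm}(n,F))^{-1}\operatorname{tr}L_\star(x\star y)$$ (the two expressions agree), a positive definite symmetric bilinear form satisfying $\hat h(x\star y,z)=\hat h(x,y\star z)$. For linearly independent $x,y\in \mathrm{Herm}(n,F)$ let $$\mathrm{sect}(x,y)=\frac{\hat h(x\star x,y\star y)-\hat h(x\star y,y\star x)}{\hat h(x,x)\hat h(y,y)-\hat h(x,y)^2}$$ be the sectional nonassociativity, which depends only on the plane spanned by $x$ and $y$. Let $\mathrm{Aut}(\mathrm{Herm}(n,F),\star)$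 be the group of real linear automorphisms preserving $\star$, and let $e_{ij}$ be the standard matrix units. Then for all linearly independent $x,y\in \mathrm{Herm}(n,F)$ $$0\le \mathrm{sect}(x,y)\le \tfrac n2 .$$ 1. If $F$ is associative, then $\mathrm{sect}(x,y)=0$ if and only if $xy=yx$ (matrix product). In particular, if $x$ and $x\star x$ are linearly independent, then $\mathrm{sect}(x,x\star x)=0$. 2. $\mathrm{sect}(x,y)=\tfrac n2$ if and only if the plane spanned by $x$ and $y$ is equivalent under $\mathrm{Aut}(\mathrm{Herm}(n,F),\star)$ to the plane spanned by $e_{11}-e_{nn}$ and $e_{1n}+e_{n1}$: there is $g\in\mathrm{Aut}(\mathrm{Herm}(n,F),\star)$ with $g(\mathrm{span}\{x,y\})=\mathrm{span}\{e_{11}-e_{nn},\,e_{1n}+e_{n1}\}$. Moreover, $\mathrm{sect}(x,y)=\tfrac n2$ and $\hat h(x,y)=0$ if and only if $x$ and $y$ themselves are simultaneously equivalent to scalar multiples of these matrices: there are $g\in\mathrm{Aut}(\mathrm{Herm}(n,F),\star)$ and $a,b\in\mathbb R$ with $g(x)=a(e_{11}-e_{nn})$ and $g(y)=b(e_{1n}+e_{n1})$.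 -/

import Mathlib

/-! ## Metrized commutative algebras and sectional nonassociativity -/

section Metrized

variable {A : Type*} [AddCommGroup A] [Module ℝ A]

/-- `(A, mlt, h)` is a metrized commutative algebra: the bilinear multiplication `mlt` is commutative
and `h` is a nondegenerate invariant symmetric bilinear form. -/
structure IsMetrizedCommutative (mlt : A →ₗ[ℝ] A →ₗ[ℝ] A) (h : LinearMap.BilinForm ℝ A) : Prop where
  mlt_comm : ∀ x y, mlt x y = mlt y x
  symm : ∀ x y, h x y = h y x
  nondegenerate : ∀ x, (∀ y, h x y = 0) → x = 0
  invariant : ∀ x y z, h (mlt x y) z = h x (mlt y z)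

/-- The sectional nonassociativity of `(A, mlt, h)` at the plane spanned by `x` and `y`. -/
noncomputable def sect (mlt : A →ₗ[ℝ] A →ₗ[ℝ] A) (h : LinearMap.BilinForm ℝ A) (x y : A) : ℝ :=
  (h (mlt x x) (mlt y y) - h (mlt x y) (mlt y x)) / (h x x * h y y - h x y ^ 2)

/-- A linear automorphism of `A` is an automorphism of the algebra `(A, mlt)`. -/
def IsAlgAut (mlt : A →ₗ[ℝ] A →ₗ[ℝ] A) (g : A ≃ₗ[ℝ] A) : Prop :=
  ∀ x y, g (mlt x y) = mlt (g x) (g y)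

end Metrized

/-! ## Real Hurwitz algebras -/

/-- A (Euclidean) real Hurwitz algebra: a nonzero, finite-dimensional, unital, not necessarily
associative real algebra with a positive definite quadratic form that is multiplicative. By Hurwitz's
theorem these are, up to isomorphism, exactly the real numbers, the complex numbers, the quaternions
and the octonions. -/
class RealHurwitzAlgebra (F : Type*) [NonAssocRing F] [Module ℝ F] : Type _ extends
    IsScalarTower ℝ F F, SMulCommClass ℝ F F, Nontrivial F, Module.Finite ℝ F where
  normForm : QuadraticForm ℝ F
  normForm_posDef : normForm.PosDef
  normForm_mul : ∀ a b, normForm (a * b) = normForm a * normForm b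

namespace RealHurwitzAlgebra

variable {F : Type*} [NonAssocRing F] [Module ℝ F] [RealHurwitzAlgebra F]

/-- The real part `a ↦ (N(a + 1) - N(a) - N(1)) / 2` of an element. -/
noncomputable def re : F →ₗ[ℝ] ℝ :=
  (1 / 2 : ℝ) • (normForm (F := F)).polarBilin.flip 1

/-- The canonical involution `a ↦ 2 re(a) 1 - a`. -/
noncomputable def conj : F →ₗ[ℝ] F :=
  (2 : ℝ) • (re (F := F)).smulRight 1 - LinearMap.id

theorem conj_apply (a : F) :
    conj a = (normForm (F := F)).polarBilin a 1 • (1 : F) - a := by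
  simp [conj, re, smul_smul]

theorem normForm_one : normForm (1 : F) = 1 := by
  have h := normForm_mul (1 : F) 1
  have h' : 0 < normForm (1 : F) := normForm_posDef 1 one_ne_zero
  rw [mul_one] at h
  nlinarith

theorem conj_one : conj (1 : F) = 1 := by
  have h : (normForm (F := F)).polarBilin 1 1 = 2 := by
    simp [QuadraticMap.polarBilin_apply_apply, normForm_one]
  rw [conj_apply, h, two_smul, add_sub_cancel_right]

private theorem normForm_add (a b : F) : normForm (a + b) =
    normForm a + normForm b + (normForm (F := F)).polarBilin a b := by
  simp [QuadraticMap.polarBilin_apply_apply, QuadraticMap.polar]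

private theorem polar_comm (a b : F) : (normForm (F := F)).polarBilin a b =
    (normForm (F := F)).polarBilin b a := by
  simp [QuadraticMap.polarBilin_apply_apply, QuadraticMap.polar_comm]

private theorem polar_mul_left (a b c : F) : (normForm (F := F)).polarBilin (a * b) (a * c) =
    normForm a * (normForm (F := F)).polarBilin b c := by
  have h := normForm_mul a (b + c)
  rw [mul_add, normForm_add, normForm_add, normForm_mul, normForm_mul] at h
  linarith

private theorem polar_mul_right (a b c : F) : (normForm (F := F)).polarBilin (b * a) (c * a) =
    normForm a * (normForm (F := F)).polarBilin b c := by
  have h := normForm_mul (b + c) a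
  rw [add_mul, normForm_add, normForm_add, normForm_mul, normForm_mul] at h
  linarith

private theorem polar_adjoint_left (a b c : F) : (normForm (F := F)).polarBilin (a * b) c =
    (normForm (F := F)).polarBilin b (conj a * c) := by
  have h := polar_mul_left (a + 1) b c
  have h1 := polar_mul_left a b c
  simp only [add_mul, one_mul, map_add, LinearMap.add_apply, normForm_add, normForm_one, h1] at h
  simp only [conj_apply, sub_mul, smul_mul_assoc, one_mul, map_sub, map_smul, smul_eq_mul]
  linarith

private theorem polar_adjoint_right (a b c : F) : (normForm (F := F)).polarBilin (a * b) c =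
    (normForm (F := F)).polarBilin a (c * conj b) := by
  have h := polar_mul_right (b + 1) a c
  have h1 := polar_mul_right b a c
  simp only [mul_add, mul_one, map_add, LinearMap.add_apply, normForm_add, normForm_one, h1] at h
  simp only [conj_apply, mul_sub, mul_smul_comm, mul_one, map_sub, map_smul, smul_eq_mul]
  linarith

private theorem polar_conj (a b : F) : (normForm (F := F)).polarBilin (conj a) b =
    (normForm (F := F)).polarBilin a (conj b) := by
  simp only [conj_apply, map_sub, map_smul, LinearMap.sub_apply, LinearMap.smul_apply, smul_eq_mul,
    polar_comm (1 : F) b]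
  ring

theorem conj_conj (a : F) : conj (conj a) = a := by
  have h : (normForm (F := F)).polarBilin (conj a) 1 = (normForm (F := F)).polarBilin a 1 := by
    rw [polar_conj, conj_one]
  rw [conj_apply (conj a), h, conj_apply, sub_sub_cancel]

theorem conj_mul (a b : F) : conj (a * b) = conj b * conj a := by
  have key : ∀ z, (normForm (F := F)).polarBilin (conj (a * b) - conj b * conj a) z = 0 := by
    intro z
    have h1 := polar_adjoint_left z a (conj b)
    have h2 := polar_adjoint_right (conj b) (conj a) z
    rw [conj_conj] at h2
    rw [map_sub, LinearMap.sub_apply, polar_conj, polar_adjoint_right a b, ← h1, h2, polar_comm,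
      sub_self]
  by_contra hne
  have hp := normForm_posDef _ (sub_ne_zero.mpr hne)
  have h0 := key (conj (a * b) - conj b * conj a)
  rw [QuadraticMap.polarBilin_apply_apply, QuadraticMap.polar_self, two_smul] at h0
  linarith

end RealHurwitzAlgebra

/-! ## Hermitian matrices with the Jordan product -/

section Hermitian

open RealHurwitzAlgebra

variable (n : ℕ) (F : Type*) [NonAssocRing F] [Module ℝ F] [RealHurwitzAlgebra F]

/-- The real vector space of Hermitian `n × n` matrices over `F`. -/
def Herm : Submodule ℝ (Matrix (Fin n) (Fin n) F) where
  carrier := {x | ∀ i j, conj (x j i) = x i j}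
  add_mem' := by
    intro x y hx hy i j
    simp [hx i j, hy i j]
  zero_mem' := by
    intro i j
    simp
  smul_mem' := by
    intro c x hx i j
    simp [hx i j]

variable {n F}

theorem Herm.jordan_mem {x y : Matrix (Fin n) (Fin n) F} (hx : x ∈ Herm n F) (hy : y ∈ Herm n F) :
    (1 / 2 : ℝ) • (x * y + y * x) ∈ Herm n F := by
  intro i j
  have hx' : ∀ i j, conj (x j i) = x i j := hx
  have hy' : ∀ i j, conj (y j i) = y i j := hy
  simp only [Matrix.smul_apply, Matrix.add_apply, Matrix.mul_apply, map_smul, map_add, map_sum,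
    RealHurwitzAlgebra.conj_mul, hx', hy']
  rw [add_comm]

variable (n F)

/-- The Jordan product `x ⋆ y = (xy + yx) / 2` on Hermitian matrices. -/
noncomputable def jordanMul : Herm n F →ₗ[ℝ] Herm n F →ₗ[ℝ] Herm n F :=
  LinearMap.mk₂ ℝ
    (fun x y => ⟨(1 / 2 : ℝ) • ((x : Matrix (Fin n) (Fin n) F) * (y : Matrix (Fin n) (Fin n) F)
      + (y : Matrix (Fin n) (Fin n) F) * (x : Matrix (Fin n) (Fin n) F)),
      Herm.jordan_mem x.2 y.2⟩)
    (by
      intro x x' y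
      ext1
      simp only [Submodule.coe_add, Matrix.add_mul, Matrix.mul_add, ← smul_add]
      congr 1
      abel)
    (by
      intro c x y
      ext1
      simp only [Submodule.coe_smul, Matrix.smul_mul, Matrix.mul_smul, ← smul_add]
      rw [smul_comm])
    (by
      intro x y y'
      ext1
      simp only [Submodule.coe_add, Matrix.add_mul, Matrix.mul_add, ← smul_add]
      congr 1
      abel)
    (by
      intro c x y
      ext1
      simp only [Submodule.coe_smul, Matrix.smul_mul, Matrix.mul_smul, ← smul_add]
      rw [smul_comm])

/-- The real-valued trace of a Hermitian matrix (whose diagonal entries are real multiples of 1). -/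
noncomputable def hermTrace : Herm n F →ₗ[ℝ] ℝ :=
  re ∘ₗ Matrix.traceLinearMap (Fin n) ℝ F ∘ₗ (Herm n F).subtype

/-- The metric `(x, y) ↦ n⁻¹ tr(x ⋆ y)`. -/
noncomputable def hermMetric : LinearMap.BilinForm ℝ (Herm n F) :=
  (jordanMul n F).compr₂ ((n : ℝ)⁻¹ • hermTrace n F)

variable {n}

/-- The Hermitian matrix `e_ii - e_jj`. -/
def hermDiff (i j : Fin n) : Herm n F :=
  ⟨Matrix.single i i 1 - Matrix.single j j 1, by
    intro k l
    simp only [Matrix.sub_apply, Matrix.single_apply, map_sub]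
    congr 1 <;> split_ifs <;> simp_all [conj_one] <;> omega⟩

/-- The Hermitian matrix `e_ij + e_ji`. -/
def hermSum (i j : Fin n) : Herm n F :=
  ⟨Matrix.single i j 1 + Matrix.single j i 1, by
    intro k l
    simp only [Matrix.add_apply, Matrix.single_apply, map_add]
    rw [add_comm]
    congr 1 <;> split_ifs <;> simp_all [conj_one]⟩

end Hermitian

/-! Everything is reduced to a diagonal `x`. Linear maps preserving the Jordan product and the trace
(`IsTraceAut`) are isometries of the metric, hence form a compact set and leave `sect` unchanged. On
an orbit of this set, choose a point where the sum of the squared diagonal entries is maximal. A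
nonzero off-diagonal entry there could first be made real without changing the diagonal, and a
Jacobi rotation would then strictly increase the sum. So the maximal point is diagonal
(`exists_isTraceAut_diagonal`). Making an entry real is conjugation by a diagonal unitary matrix if
`F` is associative; for `n = 3` the Moufang identities replace associativity.

Let `x` be diagonal with entries `l i`, and let `y` have diagonal entries `μ i`. Up to powers of
`n`, the numerator of `sect` is `∑ (l i - l j)^2 / 4 * N (y i j)`, visibly nonnegative, and the
denominator is `(∑ l i^2) * ∑ N (y i j) - (∑ l i * μ i)^2`. The upper bound combines `(l i - l j)^2
≤ 2 * (l i^2 + l j^2) ≤ 2 * ∑ l k^2` off the diagonal with Cauchy–Schwarz on it. In the equality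
case each nonzero `y i j` with `i ≠ j` forces `l j = -l i` and all other `l k = 0`; if also `x ⊥ y`,
the diagonal of `y` vanishes. A permutation and one more reality adjustment give the model pair.
Arbitrary planes reduce to orthogonal pairs by Gram–Schmidt.

In the associative case the numerator is a positive multiple of the squared norm of the commutator
`xy - yx`, which settles vanishing.

For the converses every algebra automorphism must be an isometry, even if it is not assumed to
preserve the trace. This follows because the trace is a multiple of the trace of the multiplication
operator, which is invariant under all automorphisms (`natCast_mul_traceMul`). -/

namespace RealHurwitzAlgebra

/-! ### Adjoint, cancellation and Moufang identities in a Hurwitz algebra. -/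

section HurwitzIdentities

variable {F : Type*} [NonAssocRing F] [Module ℝ F] [RealHurwitzAlgebra F]

theorem normForm_nonneg (a : F) : 0 ≤ normForm a := normForm_posDef.nonneg a

theorem normForm_eq_zero_iff (a : F) : normForm a = 0 ↔ a = 0 :=
  ⟨fun h => by
    by_contra ha
    exact (normForm_posDef a ha).ne' h, fun h => by rw [h, map_zero]⟩

theorem normForm_smul (r : ℝ) (a : F) : normForm (r • a) = r ^ 2 * normForm a := by
  rw [QuadraticMap.map_smul, smul_eq_mul, sq]

theorem normForm_smul_one (r : ℝ) : normForm (r • (1 : F)) = r ^ 2 := by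
  rw [normForm_smul, normForm_one, mul_one]

theorem normForm_add_eq (a b : F) : normForm (a + b) =
    normForm a + normForm b + (normForm (F := F)).polarBilin a b := by
  simp [QuadraticMap.polarBilin_apply_apply, QuadraticMap.polar]

theorem polarBilin_self (a : F) : (normForm (F := F)).polarBilin a a = 2 * normForm a := by
  rw [QuadraticMap.polarBilin_apply_apply, QuadraticMap.polar_self, two_smul, two_mul]

theorem polarBilin_comm (a b : F) : (normForm (F := F)).polarBilin a b =
    (normForm (F := F)).polarBilin b a := by
  simp [QuadraticMap.polarBilin_apply_apply, QuadraticMap.polar_comm]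

theorem ext_polarBilin {a b : F}
    (h : ∀ c, (normForm (F := F)).polarBilin a c = (normForm (F := F)).polarBilin b c) :
    a = b := by
  have h0 := h (a - b)
  rw [← sub_eq_zero, ← LinearMap.sub_apply, ← map_sub, polarBilin_self] at h0
  rw [← sub_eq_zero, ← normForm_eq_zero_iff]
  linarith

theorem polarBilin_map_of_normForm_map {φ : F →ₗ[ℝ] F} (hφ : ∀ a, normForm (φ a) = normForm a)
    (a b : F) : (normForm (F := F)).polarBilin (φ a) (φ b) =
      (normForm (F := F)).polarBilin a b := by
  have h := hφ (a + b)
  rw [map_add, normForm_add_eq, normForm_add_eq, hφ, hφ] at h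
  linarith

theorem polarBilin_mul_mul_left (a b c : F) :
    (normForm (F := F)).polarBilin (a * b) (a * c) =
      normForm a * (normForm (F := F)).polarBilin b c := by
  have h := normForm_mul a (b + c)
  rw [mul_add, normForm_add_eq, normForm_add_eq, normForm_mul, normForm_mul] at h
  linarith

theorem polarBilin_mul_mul_right (a b c : F) :
    (normForm (F := F)).polarBilin (b * a) (c * a) =
      normForm a * (normForm (F := F)).polarBilin b c := by
  have h := normForm_mul (b + c) a
  rw [add_mul, normForm_add_eq, normForm_add_eq, normForm_mul, normForm_mul] at h
  linarith

/-- Linearization of `polarBilin_mul_mul_left` in its outer factor. Setting one argument to `1`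
makes `conj` give the adjoints of left and right multiplication. -/
theorem polarBilin_exchange (a b c d : F) :
    (normForm (F := F)).polarBilin (a * b) (c * d) =
      (normForm (F := F)).polarBilin a c * (normForm (F := F)).polarBilin b d -
        (normForm (F := F)).polarBilin (a * d) (c * b) := by
  have h := polarBilin_mul_mul_left (a + c) b d
  have h1 := polarBilin_mul_mul_left a b d
  have h2 := polarBilin_mul_mul_left c b d
  simp only [add_mul, map_add, LinearMap.add_apply, normForm_add_eq, h1, h2] at h
  have h3 := polarBilin_comm (c * b) (a * d)
  linarith

theorem polarBilin_mul_left (a b c : F) : (normForm (F := F)).polarBilin (a * b) c =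
    (normForm (F := F)).polarBilin b (conj a * c) := by
  have h := polarBilin_exchange a b 1 c
  rw [one_mul, one_mul, polarBilin_comm (a * c)] at h
  rw [h, conj_apply, sub_mul, smul_mul_assoc, one_mul, map_sub, map_smul, smul_eq_mul]

theorem polarBilin_mul_right (a b c : F) : (normForm (F := F)).polarBilin (a * b) c =
    (normForm (F := F)).polarBilin a (c * conj b) := by
  have h := polarBilin_exchange a b c 1
  rw [mul_one, mul_one] at h
  rw [h, conj_apply, mul_sub, mul_smul_comm, mul_one, map_sub, map_smul, smul_eq_mul]
  ring

theorem polarBilin_conj_left (a b : F) : (normForm (F := F)).polarBilin (conj a) b =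
    (normForm (F := F)).polarBilin a (conj b) := by
  simp only [conj_apply, map_sub, map_smul, LinearMap.sub_apply, LinearMap.smul_apply, smul_eq_mul,
    polarBilin_comm (1 : F) b]
  ring

theorem normForm_conj (a : F) : normForm (conj a) = normForm a := by
  have h := polarBilin_conj_left a (conj a)
  rw [conj_conj, polarBilin_self, polarBilin_self] at h
  linarith

theorem conj_mul_cancel_left (a b : F) : conj a * (a * b) = normForm a • b := by
  refine ext_polarBilin fun c => ?_
  rw [polarBilin_mul_left, conj_conj, polarBilin_mul_mul_left, map_smul, LinearMap.smul_apply,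
    smul_eq_mul]

theorem mul_conj_cancel_left (a b : F) : a * (conj a * b) = normForm a • b := by
  simpa [conj_conj, normForm_conj] using conj_mul_cancel_left (conj a) b

theorem mul_conj_cancel_right (a b : F) : (b * a) * conj a = normForm a • b := by
  refine ext_polarBilin fun c => ?_
  rw [polarBilin_mul_right, conj_conj, polarBilin_mul_mul_right, map_smul, LinearMap.smul_apply,
    smul_eq_mul]

theorem conj_mul_cancel_right (a b : F) : (b * conj a) * a = normForm a • b := by
  simpa [conj_conj, normForm_conj] using mul_conj_cancel_right (conj a) b

theorem mul_conj_self (a : F) : a * conj a = normForm a • (1 : F) := by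
  simpa using mul_conj_cancel_left a 1

theorem conj_mul_self (a : F) : conj a * a = normForm a • (1 : F) := by
  simpa using conj_mul_cancel_left a 1

theorem mul_conj_add_mul_conj (a b : F) :
    a * conj b + b * conj a = (normForm (F := F)).polarBilin a b • (1 : F) := by
  have h := mul_conj_self (a + b)
  rw [normForm_add_eq, map_add, mul_add, add_mul, add_mul, mul_conj_self, mul_conj_self,
    add_smul, add_smul] at h
  have h' : a * conj b + b * conj a =
      (normForm a • (1 : F) + b * conj a + (a * conj b + normForm b • 1)) -
        (normForm a • 1 + normForm b • 1) := by abel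
  rw [h', h]
  abel

theorem re_apply (a : F) : re a = (normForm (F := F)).polarBilin a 1 / 2 := by
  simp [re]
  ring

theorem re_one : re (1 : F) = 1 := by
  rw [re_apply, polarBilin_self, normForm_one]
  norm_num

theorem re_smul_one (r : ℝ) : re (r • (1 : F)) = r := by
  rw [map_smul, re_one, smul_eq_mul, mul_one]

theorem conj_smul_one (r : ℝ) : conj (r • (1 : F)) = r • 1 := by
  rw [map_smul, conj_one]

theorem eq_re_smul_one_of_conj_eq {a : F} (h : conj a = a) : a = re a • (1 : F) := by
  have h1 := conj_apply a
  rw [h] at h1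
  have h2 : (2 : ℝ) • a = (2 : ℝ) • (re a • (1 : F)) := by
    rw [smul_smul, re_apply, mul_div_cancel₀ _ two_ne_zero, two_smul]
    nth_rewrite 1 [h1]
    abel
  exact smul_right_injective F (two_ne_zero (α := ℝ)) h2

theorem re_mul (a b : F) : re (a * b) = (normForm (F := F)).polarBilin a (conj b) / 2 := by
  rw [re_apply, polarBilin_mul_right, one_mul]

theorem re_mul_comm (a b : F) : re (a * b) = re (b * a) := by
  rw [re_mul, re_mul, ← polarBilin_conj_left, polarBilin_comm]

/-- Adjointness of multiplication makes the real part associative even when `F` is not; all trace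
identities below rest on this. -/
theorem re_mul_assoc (a b c : F) : re (a * b * c) = re (a * (b * c)) := by
  rw [re_mul, re_mul, polarBilin_mul_right, conj_mul]

/-- The right side sees `x` and `y` only through `x * y`, so comparing with the pair `(x * y, 1)`
yields the middle Moufang identity. -/
theorem mul_mul_mul_eq_smul_sub (u x y : F) : (u * x) * (y * u) =
    (normForm (F := F)).polarBilin (x * y) (conj u) • u - normForm u • conj (x * y) := by
  refine ext_polarBilin fun t => ?_
  rw [polarBilin_mul_right, conj_mul, polarBilin_exchange, mul_conj_cancel_left, map_sub, map_smul,
    map_smul, map_smul, LinearMap.sub_apply, LinearMap.smul_apply, LinearMap.smul_apply,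
    LinearMap.smul_apply, smul_eq_mul, smul_eq_mul, smul_eq_mul, polarBilin_mul_right x y, conj_mul,
    polarBilin_mul_right (conj y), conj_conj]
  ring

theorem middle_moufang (u x y : F) : (u * x) * (y * u) = u * (x * y) * u := by
  have h := mul_mul_mul_eq_smul_sub u (x * y) 1
  rw [one_mul, mul_one] at h
  rw [h, mul_mul_mul_eq_smul_sub]

theorem left_moufang (u x y : F) : (u * x * u) * y = u * (x * (u * y)) := by
  have h := mul_mul_mul_eq_smul_sub u x 1
  rw [one_mul, mul_one] at h
  refine ext_polarBilin fun t => ?_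
  rw [h, polarBilin_mul_left u, polarBilin_exchange x, conj_mul_cancel_left, map_smul,
    smul_eq_mul, polarBilin_mul_left x t, polarBilin_comm t, sub_mul, smul_mul_assoc,
    smul_mul_assoc, map_sub, map_smul, map_smul, LinearMap.sub_apply, LinearMap.smul_apply,
    LinearMap.smul_apply, smul_eq_mul, smul_eq_mul]

/-- The involution reverses products and so carries the left identity to the right one. -/
theorem right_moufang (u x y : F) : y * (u * x * u) = ((y * u) * x) * u := by
  have h := congrArg conj (left_moufang (conj u) (conj x) (conj y))
  simp only [conj_mul, conj_conj] at h
  have h' := middle_moufang u 1 x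
  rw [mul_one, one_mul] at h'
  rw [← h, h']

end HurwitzIdentities

end RealHurwitzAlgebra

/-! ### The trace form on Hermitian matrices. -/

section HermMetric

open RealHurwitzAlgebra

variable {n : ℕ} {F : Type*} [NonAssocRing F] [Module ℝ F] [RealHurwitzAlgebra F]

theorem herm_conj_apply_apply (x : Herm n F) (i j : Fin n) :
    conj ((x : Matrix (Fin n) (Fin n) F) i j) = (x : Matrix (Fin n) (Fin n) F) j i :=
  x.2 j i

theorem herm_apply_self_eq (x : Herm n F) (i : Fin n) :
    (x : Matrix (Fin n) (Fin n) F) i i =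
      re ((x : Matrix (Fin n) (Fin n) F) i i) • (1 : F) :=
  eq_re_smul_one_of_conj_eq (herm_conj_apply_apply x i i)

theorem coe_jordanMul (x y : Herm n F) :
    (jordanMul n F x y : Matrix (Fin n) (Fin n) F) =
      (1 / 2 : ℝ) • ((x : Matrix (Fin n) (Fin n) F) * (y : Matrix (Fin n) (Fin n) F)
        + (y : Matrix (Fin n) (Fin n) F) * (x : Matrix (Fin n) (Fin n) F)) := rfl

theorem jordanMul_comm (x y : Herm n F) : jordanMul n F x y = jordanMul n F y x := by
  ext1
  rw [coe_jordanMul, coe_jordanMul, add_comm]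

/-- The real part of the trace of a square matrix. -/
noncomputable def reTrace (n : ℕ) (F : Type*) [NonAssocRing F] [Module ℝ F]
    [RealHurwitzAlgebra F] : Matrix (Fin n) (Fin n) F →ₗ[ℝ] ℝ :=
  re ∘ₗ Matrix.traceLinearMap (Fin n) ℝ F

theorem hermTrace_apply (x : Herm n F) :
    hermTrace n F x = reTrace n F (x : Matrix (Fin n) (Fin n) F) := rfl

theorem reTrace_apply (A : Matrix (Fin n) (Fin n) F) : reTrace n F A = ∑ i, re (A i i) := by
  simp [reTrace, Matrix.trace]

theorem hermTrace_eq_sum (x : Herm n F) :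
    hermTrace n F x = ∑ i, re ((x : Matrix (Fin n) (Fin n) F) i i) := by
  rw [hermTrace_apply, reTrace_apply]

theorem reTrace_mul (A B : Matrix (Fin n) (Fin n) F) :
    reTrace n F (A * B) = ∑ i, ∑ j, re (A i j * B j i) := by
  simp [reTrace_apply, Matrix.mul_apply, map_sum]

theorem reTrace_mul_comm (A B : Matrix (Fin n) (Fin n) F) :
    reTrace n F (A * B) = reTrace n F (B * A) := by
  rw [reTrace_mul, reTrace_mul, Finset.sum_comm]
  simp only [re_mul_comm]

theorem reTrace_mul_assoc (A B C : Matrix (Fin n) (Fin n) F) :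
    reTrace n F (A * B * C) = reTrace n F (A * (B * C)) := by
  rw [reTrace_mul, reTrace_mul]
  simp only [Matrix.mul_apply, Finset.sum_mul, Finset.mul_sum, map_sum, re_mul_assoc]
  refine Finset.sum_congr rfl fun i _ => ?_
  rw [Finset.sum_comm]

theorem hermMetric_eq_reTrace (x y : Herm n F) : hermMetric n F x y =
    (n : ℝ)⁻¹ * reTrace n F
      ((x : Matrix (Fin n) (Fin n) F) * (y : Matrix (Fin n) (Fin n) F)) := by
  change (n : ℝ)⁻¹ * hermTrace n F (jordanMul n F x y) = _
  rw [hermTrace_apply, coe_jordanMul, map_smul, map_add,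
    reTrace_mul_comm (y : Matrix (Fin n) (Fin n) F), smul_eq_mul]
  ring

theorem hermMetric_eq_hermTrace (x y : Herm n F) :
    hermMetric n F x y = (n : ℝ)⁻¹ * hermTrace n F (jordanMul n F x y) := rfl

theorem hermMetric_eq_sum (x y : Herm n F) : hermMetric n F x y =
    (n : ℝ)⁻¹ * ∑ i, ∑ j, (normForm (F := F)).polarBilin
      ((x : Matrix (Fin n) (Fin n) F) i j) ((y : Matrix (Fin n) (Fin n) F) i j) / 2 := by
  rw [hermMetric_eq_reTrace, reTrace_mul]
  simp only [re_mul, herm_conj_apply_apply]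

theorem hermMetric_self (x : Herm n F) : hermMetric n F x x =
    (n : ℝ)⁻¹ * ∑ i, ∑ j, normForm ((x : Matrix (Fin n) (Fin n) F) i j) := by
  rw [hermMetric_eq_sum]
  simp only [polarBilin_self, mul_div_cancel_left₀ _ (two_ne_zero (α := ℝ))]

theorem hermMetric_comm (x y : Herm n F) : hermMetric n F x y = hermMetric n F y x := by
  rw [hermMetric_eq_reTrace, reTrace_mul_comm, hermMetric_eq_reTrace]

theorem hermMetric_invariant (x y z : Herm n F) :
    hermMetric n F (jordanMul n F x y) z = hermMetric n F x (jordanMul n F y z) := by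
  simp only [hermMetric_eq_reTrace, coe_jordanMul, smul_mul_assoc, mul_smul_comm, map_smul,
    Matrix.add_mul, Matrix.mul_add, map_add]
  rw [reTrace_mul_assoc (x : Matrix (Fin n) (Fin n) F),
    reTrace_mul_comm _ (z : Matrix (Fin n) (Fin n) F),
    ← reTrace_mul_assoc (z : Matrix (Fin n) (Fin n) F),
    reTrace_mul_comm _ (x : Matrix (Fin n) (Fin n) F)]

theorem hermMetric_self_pos (hn : 0 < n) (x : Herm n F) (hx : x ≠ 0) :
    0 < hermMetric n F x x := by
  rw [hermMetric_self]
  refine mul_pos (by positivity) ?_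
  obtain ⟨i, j, hij⟩ : ∃ i j, (x : Matrix (Fin n) (Fin n) F) i j ≠ 0 := by
    by_contra! h
    exact hx (Subtype.ext (Matrix.ext h))
  refine Finset.sum_pos' (fun i _ => Finset.sum_nonneg fun j _ => normForm_nonneg _)
    ⟨i, Finset.mem_univ _, ?_⟩
  exact Finset.sum_pos' (fun j _ => normForm_nonneg _)
    ⟨j, Finset.mem_univ _, normForm_posDef _ hij⟩

theorem isMetrizedCommutative_herm (hn : 0 < n) :
    IsMetrizedCommutative (jordanMul n F) (hermMetric n F) where
  mlt_comm := jordanMul_comm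
  symm := hermMetric_comm
  nondegenerate x h := by
    by_contra hx
    exact (hermMetric_self_pos hn x hx).ne' (h x)
  invariant := hermMetric_invariant

end HermMetric

/-! ### Sectional nonassociativity as a function of the plane. -/

section SectPlane

variable {A : Type*} [AddCommGroup A] [Module ℝ A]
  {mlt : A →ₗ[ℝ] A →ₗ[ℝ] A} {h : LinearMap.BilinForm ℝ A}

/-- Numerator and denominator are both multiplied by the square of the determinant of the change of
basis. -/
theorem IsMetrizedCommutative.sect_smul_add (H : IsMetrizedCommutative mlt h) (u v : A)
    (a b c d : ℝ) (hdet : a * d - b * c ≠ 0) :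
    sect mlt h (a • u + b • v) (c • u + d • v) = sect mlt h u v := by
  have h1 : h (mlt u v) (mlt u u) = h (mlt u u) (mlt u v) := H.symm _ _
  have h2 : h (mlt v v) (mlt u u) = h (mlt u u) (mlt v v) := H.symm _ _
  have h3 : h (mlt v v) (mlt u v) = h (mlt u v) (mlt v v) := H.symm _ _
  have h4 : h v u = h u v := H.symm _ _
  unfold sect
  rw [← mul_div_mul_left (h (mlt u u) (mlt v v) - h (mlt u v) (mlt v u))
    (h u u * h v v - h u v ^ 2) (pow_ne_zero 2 hdet)]
  simp only [map_add, map_smul, LinearMap.add_apply, LinearMap.smul_apply, smul_eq_mul,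
    H.mlt_comm v u, h1, h2, h3, h4]
  congr 1 <;> ring

theorem IsMetrizedCommutative.sect_eq_of_span_eq (H : IsMetrizedCommutative mlt h) {x y u v : A}
    (hxy : LinearIndependent ℝ ![x, y])
    (hs : Submodule.span ℝ {x, y} = Submodule.span ℝ {u, v}) :
    sect mlt h x y = sect mlt h u v := by
  have hx : x ∈ Submodule.span ℝ {u, v} := hs ▸ Submodule.subset_span (by simp)
  have hy : y ∈ Submodule.span ℝ {u, v} := hs ▸ Submodule.subset_span (by simp)
  obtain ⟨a, b, rfl⟩ := Submodule.mem_span_pair.1 hx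
  obtain ⟨c, d, rfl⟩ := Submodule.mem_span_pair.1 hy
  refine H.sect_smul_add u v a b c d fun hdet => ?_
  rw [LinearIndependent.pair_iff] at hxy
  have e1 := hxy d (-b) (by
    rw [show d • (a • u + b • v) + -b • (c • u + d • v) = (a * d - b * c) • u by module, hdet,
      zero_smul])
  have e2 := hxy (-c) a (by
    rw [show -c • (a • u + b • v) + a • (c • u + d • v) = (a * d - b * c) • v by module, hdet,
      zero_smul])
  have e3 := hxy 1 0 (by simp [e2.2, neg_eq_zero.1 e1.2])
  exact one_ne_zero e3.1

theorem IsMetrizedCommutative.gram_pos (H : IsMetrizedCommutative mlt h)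
    (hpos : ∀ x, x ≠ 0 → 0 < h x x) {x y : A} (hxy : LinearIndependent ℝ ![x, y]) :
    0 < h x x * h y y - h x y ^ 2 := by
  rw [LinearIndependent.pair_iff] at hxy
  have hx : 0 < h x x := hpos x fun hx => one_ne_zero (hxy 1 0 (by simp [hx])).1
  -- Gram–Schmidt without division: the squared length of this vector is `h x x` times the Gram
  -- determinant.
  have hz := hpos (h x x • y - h x y • x) fun hz => hx.ne' (hxy (-h x y) (h x x) (by
    rw [← hz]; module)).2
  simp only [map_sub, map_smul, LinearMap.sub_apply, LinearMap.smul_apply, smul_eq_mul,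
    H.symm y x] at hz
  have hz' : 0 < h x x * (h x x * h y y - h x y ^ 2) := by linarith
  exact (pos_iff_pos_of_mul_pos hz').1 hx

theorem sect_map {mlt : A →ₗ[ℝ] A →ₗ[ℝ] A} {h : LinearMap.BilinForm ℝ A} {g : A →ₗ[ℝ] A}
    (hg : ∀ x y, g (mlt x y) = mlt (g x) (g y)) (hh : ∀ x y, h (g x) (g y) = h x y) (x y : A) :
    sect mlt h (g x) (g y) = sect mlt h x y := by
  simp only [sect, ← hg, hh]

end SectPlane

/-! ### Trace preserving automorphisms: permutations, real orthogonal matrices, entrywise maps. -/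

section TraceAut

open RealHurwitzAlgebra

variable {n : ℕ} {F : Type*} [NonAssocRing F] [Module ℝ F] [RealHurwitzAlgebra F]

/-- A linear endomorphism of `Herm n F` preserving the Jordan product and the trace. -/
structure IsTraceAut (g : Herm n F →ₗ[ℝ] Herm n F) : Prop where
  map_mul : ∀ x y, g (jordanMul n F x y) = jordanMul n F (g x) (g y)
  map_trace : ∀ x, hermTrace n F (g x) = hermTrace n F x

namespace IsTraceAut

variable {g g' : Herm n F →ₗ[ℝ] Herm n F}

theorem comp (hg : IsTraceAut g) (hg' : IsTraceAut g') : IsTraceAut (g ∘ₗ g') where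
  map_mul x y := by simp [hg.map_mul, hg'.map_mul]
  map_trace x := by simp [hg.map_trace, hg'.map_trace]

theorem map_metric (hg : IsTraceAut g) (x y : Herm n F) :
    hermMetric n F (g x) (g y) = hermMetric n F x y := by
  rw [hermMetric_eq_hermTrace, hermMetric_eq_hermTrace, ← hg.map_mul, hg.map_trace]

theorem injective (hn : 0 < n) (hg : IsTraceAut g) : Function.Injective g := by
  rw [injective_iff_map_eq_zero]
  intro x hx
  by_contra h
  have h' := hermMetric_self_pos hn x h
  rw [← hg.map_metric, hx, map_zero] at h'
  exact h'.ne rfl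

/-- The linear equivalence underlying a trace preserving endomorphism. -/
noncomputable def toLinearEquiv (hn : 0 < n) (hg : IsTraceAut g) : Herm n F ≃ₗ[ℝ] Herm n F :=
  LinearEquiv.ofInjectiveEndo g (hg.injective hn)

theorem toLinearEquiv_apply (hn : 0 < n) (hg : IsTraceAut g) (x : Herm n F) :
    hg.toLinearEquiv hn x = g x := rfl

theorem isAlgAut_toLinearEquiv (hn : 0 < n) (hg : IsTraceAut g) :
    IsAlgAut (jordanMul n F) (hg.toLinearEquiv hn) := hg.map_mul

theorem sect_eq (hg : IsTraceAut g) (x y : Herm n F) :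
    sect (jordanMul n F) (hermMetric n F) (g x) (g y) =
      sect (jordanMul n F) (hermMetric n F) x y :=
  sect_map hg.map_mul hg.map_metric x y

theorem linearIndependent (hn : 0 < n) (hg : IsTraceAut g) {x y : Herm n F}
    (h : LinearIndependent ℝ ![x, y]) : LinearIndependent ℝ ![g x, g y] := by
  rw [LinearIndependent.pair_iff] at h ⊢
  intro s t hst
  refine h s t (hg.injective hn ?_)
  rw [map_add, map_smul, map_smul, hst, map_zero]

/-- A linear map of matrices that preserves Hermitian matrices, their products and their trace
restricts to a trace preserving automorphism. -/
theorem of_matrix {Φ : Matrix (Fin n) (Fin n) F →ₗ[ℝ] Matrix (Fin n) (Fin n) F}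
    (hΦ : ∀ x ∈ Herm n F, Φ x ∈ Herm n F)
    (hmul : ∀ x ∈ Herm n F, ∀ y ∈ Herm n F, Φ (x * y + y * x) = Φ x * Φ y + Φ y * Φ x)
    (htr : ∀ x ∈ Herm n F, reTrace n F (Φ x) = reTrace n F x) : IsTraceAut (Φ.restrict hΦ) where
  map_mul x y := by
    ext1
    rw [LinearMap.coe_restrict_apply, coe_jordanMul, coe_jordanMul, map_smul,
      hmul x x.2 y y.2]
    rfl
  map_trace x := htr x x.2

end IsTraceAut

/-- Simultaneous permutation of rows and columns. -/
theorem exists_isTraceAut_perm (σ : Equiv.Perm (Fin n)) :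
    ∃ g : Herm n F →ₗ[ℝ] Herm n F, IsTraceAut g ∧ ∀ x k l,
      (g x : Matrix (Fin n) (Fin n) F) k l = (x : Matrix (Fin n) (Fin n) F) (σ k) (σ l) := by
  let Φ : Matrix (Fin n) (Fin n) F →ₗ[ℝ] Matrix (Fin n) (Fin n) F :=
    { toFun := fun A => A.submatrix σ σ
      map_add' := fun _ _ => rfl
      map_smul' := fun _ _ => rfl }
  refine ⟨_, IsTraceAut.of_matrix (Φ := Φ) (fun x hx k l => hx _ _) (fun x _ y _ => ?_)
    (fun x _ => ?_), fun x k l => rfl⟩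
  · change (x * y + y * x).submatrix σ σ =
      x.submatrix σ σ * y.submatrix σ σ + y.submatrix σ σ * x.submatrix σ σ
    rw [Matrix.submatrix_mul_equiv, Matrix.submatrix_mul_equiv]
    rfl
  · rw [reTrace_apply, reTrace_apply]
    exact Equiv.sum_comp σ fun i => re (x i i)

/-- Conjugation by a real matrix. -/
def realConj (R : Matrix (Fin n) (Fin n) ℝ) :
    Matrix (Fin n) (Fin n) F →ₗ[ℝ] Matrix (Fin n) (Fin n) F where
  toFun A := Matrix.of fun k l => ∑ p, ∑ q, (R k p * R l q) • A p q
  map_add' A B := by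
    ext k l
    simp [Finset.sum_add_distrib]
  map_smul' c A := by
    ext k l
    simp [Finset.smul_sum, smul_comm c]

omit [RealHurwitzAlgebra F] in
theorem realConj_apply (R : Matrix (Fin n) (Fin n) ℝ) (A : Matrix (Fin n) (Fin n) F)
    (k l : Fin n) : realConj R A k l = ∑ p, ∑ q, (R k p * R l q) • A p q := rfl

/-- Real scalars pass freely through products in `F`, so the inner copies of `R` contract by
orthogonality with no associativity of `F`. -/
theorem realConj_mul {R : Matrix (Fin n) (Fin n) ℝ}
    (hR : ∀ p q, ∑ m, R m p * R m q = if p = q then 1 else 0)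
    (A B : Matrix (Fin n) (Fin n) F) : realConj R (A * B) = realConj R A * realConj R B := by
  ext k l
  have hA : ∀ m, realConj R A k m = ∑ q, R m q • ∑ p, R k p • A p q := by
    intro m
    rw [realConj_apply, Finset.sum_comm]
    simp only [Finset.smul_sum, smul_smul, mul_comm]
  have hB : ∀ m, realConj R B m l = ∑ r, R m r • ∑ s, R l s • B r s := by
    intro m
    rw [realConj_apply]
    simp only [Finset.smul_sum, smul_smul]
  have hAB : ∀ m, realConj R A k m * realConj R B m l = ∑ q, ∑ r,
      (R m q * R m r) • ((∑ p, R k p • A p q) * ∑ s, R l s • B r s) := by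
    intro m
    rw [hA, hB, Finset.sum_mul_sum]
    simp only [smul_mul_smul_comm]
  have hT : ∀ T : Fin n → Fin n → F,
      ∑ m, ∑ q, ∑ r, (R m q * R m r) • T q r = ∑ q, T q q := by
    intro T
    rw [Finset.sum_comm]
    refine Finset.sum_congr rfl fun q _ => ?_
    rw [Finset.sum_comm]
    simp [← Finset.sum_smul, hR]
  rw [Matrix.mul_apply]
  simp only [hAB]
  rw [hT fun q r => (∑ p, R k p • A p q) * ∑ s, R l s • B r s]
  simp only [realConj_apply, Matrix.mul_apply, Finset.sum_mul_sum, Finset.smul_sum,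
    smul_mul_smul_comm]
  rw [Finset.sum_comm]
  conv_rhs => rw [Finset.sum_comm]
  rw [Finset.sum_comm]
  refine Finset.sum_congr rfl fun p _ => ?_
  rw [Finset.sum_comm]

theorem realConj_mem_herm (R : Matrix (Fin n) (Fin n) ℝ) {A : Matrix (Fin n) (Fin n) F}
    (hA : A ∈ Herm n F) : realConj R A ∈ Herm n F := by
  intro k l
  have hA' : ∀ i j, conj (A j i) = A i j := hA
  simp only [realConj_apply, map_sum, map_smul, hA']
  rw [Finset.sum_comm]
  simp only [mul_comm]

theorem reTrace_realConj {R : Matrix (Fin n) (Fin n) ℝ}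
    (hR : ∀ p q, ∑ m, R m p * R m q = if p = q then 1 else 0)
    (A : Matrix (Fin n) (Fin n) F) : reTrace n F (realConj R A) = reTrace n F A := by
  simp only [reTrace_apply, realConj_apply, map_sum, map_smul, smul_eq_mul]
  rw [Finset.sum_comm]
  refine Finset.sum_congr rfl fun p _ => ?_
  rw [Finset.sum_comm]
  simp [← Finset.sum_mul, hR]

/-- Conjugation by a real orthogonal matrix. -/
theorem exists_isTraceAut_orthogonal (R : Matrix (Fin n) (Fin n) ℝ)
    (hR : ∀ p q, ∑ m, R m p * R m q = if p = q then 1 else 0) :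
    ∃ g : Herm n F →ₗ[ℝ] Herm n F, IsTraceAut g ∧ ∀ x k l,
      (g x : Matrix (Fin n) (Fin n) F) k l =
        ∑ p, ∑ q, (R k p * R l q) • (x : Matrix (Fin n) (Fin n) F) p q :=
  ⟨_, IsTraceAut.of_matrix (Φ := realConj R) (fun _ => realConj_mem_herm R)
    (fun x _ y _ => by rw [map_add, realConj_mul hR, realConj_mul hR])
    (fun x _ => reTrace_realConj hR x), fun _ _ _ => rfl⟩

/-- Entrywise application of linear maps to a Hermitian matrix. -/
theorem exists_isTraceAut_entrywise (φ : Fin n → Fin n → F →ₗ[ℝ] F)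
    (hconj : ∀ k l a, conj (φ k l a) = φ l k (conj a))
    (hnorm : ∀ k l a, normForm (φ k l a) = normForm a)
    (hone : ∀ k, φ k k 1 = 1)
    (hmul : ∀ k l m, k ≠ l → l ≠ m → k ≠ m → ∀ a b, φ k l a * φ l m b = φ k m (a * b)) :
    ∃ g : Herm n F →ₗ[ℝ] Herm n F, IsTraceAut g ∧ ∀ x k l,
      (g x : Matrix (Fin n) (Fin n) F) k l = φ k l ((x : Matrix (Fin n) (Fin n) F) k l) := by
  let Φ : Matrix (Fin n) (Fin n) F →ₗ[ℝ] Matrix (Fin n) (Fin n) F :=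
    { toFun := fun A => Matrix.of fun k l => φ k l (A k l)
      map_add' := fun _ _ => by ext; simp
      map_smul' := fun _ _ => by ext; simp }
  have hΦ : ∀ A k l, Φ A k l = φ k l (A k l) := fun _ _ _ => rfl
  have hdiag : ∀ x ∈ Herm n F, ∀ k, ∃ r : ℝ, x k k = r • (1 : F) :=
    fun x hx k => ⟨_, eq_re_smul_one_of_conj_eq (hx k k)⟩
  have hoff : ∀ x ∈ Herm n F, ∀ y ∈ Herm n F, ∀ k l m, k ≠ m →
      φ k l (x k l) * φ l m (y l m) = φ k m (x k l * y l m) := by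
    intro x hx y hy k l m hkm
    rcases eq_or_ne k l with rfl | hkl
    · obtain ⟨r, hr⟩ := hdiag x hx k
      simp [hr, hone]
    rcases eq_or_ne l m with rfl | hlm
    · obtain ⟨r, hr⟩ := hdiag y hy l
      simp [hr, hone]
    exact hmul k l m hkl hlm hkm _ _
  refine ⟨_, IsTraceAut.of_matrix (Φ := Φ) (fun x hx k l => ?_) (fun x hx y hy => ?_)
    (fun x hx => ?_), fun x k l => rfl⟩
  · rw [hΦ, hΦ, hconj, show conj (x l k) = x k l from hx k l]
  · ext k m
    rw [hΦ, Matrix.add_apply, Matrix.add_apply]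
    simp only [Matrix.mul_apply, hΦ, ← Finset.sum_add_distrib, map_sum]
    refine Finset.sum_congr rfl fun l _ => ?_
    -- On the diagonal the symmetrized product is a polar form times `1`, so norm preservation
    -- suffices. Off the diagonal, multiplicativity is needed only for three distinct indices, since
    -- diagonal entries are real.
    rcases eq_or_ne k m with rfl | hkm
    · have hx' : x l k = conj (x k l) := (hx l k).symm
      have hy' : y l k = conj (y k l) := (hy l k).symm
      rw [hx', hy', ← hconj, ← hconj, mul_conj_add_mul_conj, mul_conj_add_mul_conj,
        polarBilin_map_of_normForm_map (hnorm k l), map_smul, hone]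
    · rw [map_add, hoff x hx y hy k l m hkm, hoff y hy x hx k l m hkm]
  · rw [reTrace_apply, reTrace_apply]
    refine Finset.sum_congr rfl fun k _ => ?_
    obtain ⟨r, hr⟩ := hdiag x hx k
    rw [hΦ, hr, map_smul, hone]

end TraceAut

/-! ### Making an off-diagonal entry real. -/

section RealEntry

open RealHurwitzAlgebra

variable {n : ℕ} {F : Type*} [NonAssocRing F] [Module ℝ F] [RealHurwitzAlgebra F]

namespace RealHurwitzAlgebra

theorem exists_normForm_smul_eq_one {v : F} (hv : v ≠ 0) :
    ∃ c : ℝ, normForm (c • v) = 1 := by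
  have h := normForm_posDef v hv
  refine ⟨(√(normForm v))⁻¹, ?_⟩
  rw [normForm_smul, inv_pow, Real.sq_sqrt h.le, inv_mul_cancel₀ h.ne']

theorem exists_mul_conj_eq_smul_one (a : F) :
    ∃ u : F, normForm u = 1 ∧ ∃ r : ℝ, a * conj u = r • (1 : F) := by
  rcases eq_or_ne a 0 with rfl | ha
  · exact ⟨1, normForm_one, 0, by simp⟩
  · obtain ⟨c, hc⟩ := exists_normForm_smul_eq_one ha
    exact ⟨c • a, hc, c * normForm a, by
      rw [map_smul, mul_smul_comm, mul_conj_self, smul_smul]⟩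

/-- With `s = |a|`, the vector `v = s + conj a` bisects the angle between `1` and `conj a`, so its
normalization acts as an inverse square root of the direction of `a`; concretely `v * a = s • conj
v`. If `v = 0`, then `a = -s` is already real. -/
theorem exists_mul_mul_eq_smul_one (a : F) :
    ∃ u : F, normForm u = 1 ∧ ∃ r : ℝ, u * a * u = r • (1 : F) := by
  set s := √(normForm a) with hs
  have hs2 : normForm a = s * s := (Real.mul_self_sqrt (normForm_nonneg a)).symm
  rcases eq_or_ne (s • (1 : F) + conj a) 0 with hv | hv
  · refine ⟨1, normForm_one, -s, ?_⟩
    have h := congrArg conj hv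
    rw [map_add, conj_conj, conj_smul_one, map_zero] at h
    rw [one_mul, mul_one, neg_smul]
    exact (neg_eq_of_add_eq_zero_right h).symm
  · obtain ⟨c, hc⟩ := exists_normForm_smul_eq_one hv
    refine ⟨_, hc, c * (c * (s * normForm (s • (1 : F) + conj a))), ?_⟩
    have h : (s • (1 : F) + conj a) * a = s • conj (s • (1 : F) + conj a) := by
      rw [add_mul, conj_mul_self, hs2, map_add, conj_conj, conj_smul_one, smul_mul_assoc, one_mul,
        smul_add, smul_smul, add_comm]
    simp only [smul_mul_assoc, mul_smul_comm, h, conj_mul_self, smul_smul]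
    congr 1
    ring

end RealHurwitzAlgebra

/-- Entrywise maps satisfying the hypotheses of `exists_isTraceAut_entrywise`. -/
structure IsEntrywiseAut {ι : Type*} (φ : ι → ι → F →ₗ[ℝ] F) : Prop where
  conj_map : ∀ k l a, conj (φ k l a) = φ l k (conj a)
  normForm_map : ∀ k l a, normForm (φ k l a) = normForm a
  map_one : ∀ k, φ k k 1 = 1
  map_mul : ∀ k l m, k ≠ l → l ≠ m → k ≠ m → ∀ a b, φ k l a * φ l m b = φ k m (a * b)

theorem IsEntrywiseAut.comp_injective {ι κ : Type*} {φ : ι → ι → F →ₗ[ℝ] F}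
    (h : IsEntrywiseAut φ) {ρ : κ → ι} (hρ : Function.Injective ρ) :
    IsEntrywiseAut fun k l => φ (ρ k) (ρ l) where
  conj_map _ _ := h.conj_map _ _
  normForm_map _ _ := h.normForm_map _ _
  map_one _ := h.map_one _
  map_mul _ _ _ hkl hlm hkm := h.map_mul _ _ _ (hρ.ne hkl) (hρ.ne hlm) (hρ.ne hkm)

/-- Conjugation by the diagonal matrix with entries `d`. -/
noncomputable def diagConjMap {ι : Type*} (d : ι → F) (k l : ι) : F →ₗ[ℝ] F :=
  LinearMap.mulRight ℝ (conj (d l)) ∘ₗ LinearMap.mulLeft ℝ (d k)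

theorem diagConjMap_apply {ι : Type*} (d : ι → F) (k l : ι) (a : F) :
    diagConjMap d k l a = d k * a * conj (d l) := rfl

theorem isEntrywiseAut_diagConjMap (hassoc : ∀ a b c : F, a * b * c = a * (b * c)) {ι : Type*}
    {d : ι → F} (hd : ∀ k, normForm (d k) = 1) : IsEntrywiseAut (diagConjMap d) where
  conj_map k l a := by
    simp only [diagConjMap_apply, RealHurwitzAlgebra.conj_mul, RealHurwitzAlgebra.conj_conj, hassoc]
  normForm_map k l a := by
    simp only [diagConjMap_apply, normForm_mul, normForm_conj, hd, one_mul, mul_one]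
  map_one k := by
    rw [diagConjMap_apply, mul_one, mul_conj_self, hd, one_smul]
  map_mul k l m _ _ _ a b := by
    simp only [diagConjMap_apply, hassoc]
    rw [conj_mul_cancel_left, hd, one_smul]

/-- The triality-type maps attached to an element `u`. -/
noncomputable def moufangMap (u : F) : Fin 3 → Fin 3 → F →ₗ[ℝ] F :=
  ![![LinearMap.id, LinearMap.mulLeft ℝ u, LinearMap.mulRight ℝ u ∘ₗ LinearMap.mulLeft ℝ u],
    ![LinearMap.mulRight ℝ (conj u), LinearMap.id, LinearMap.mulRight ℝ u],
    ![LinearMap.mulRight ℝ (conj u) ∘ₗ LinearMap.mulLeft ℝ (conj u), LinearMap.mulLeft ℝ (conj u),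
      LinearMap.id]]

/-- Formally this is conjugation by `diag(u, 1, conj u)`, acting trivially on the real diagonal.
Each of the six multiplicativity relations is a Moufang identity, possibly after cancelling `u`
against `conj u`. -/
theorem isEntrywiseAut_moufangMap {u : F} (hu : normForm u = 1) :
    IsEntrywiseAut (moufangMap u) where
  conj_map k l a := by
    have h := middle_moufang (conj u) 1 (conj a)
    rw [mul_one, one_mul] at h
    have h' := middle_moufang u 1 (conj a)
    rw [mul_one, one_mul] at h'
    fin_cases k <;> fin_cases l <;>
      simp [moufangMap, RealHurwitzAlgebra.conj_mul, RealHurwitzAlgebra.conj_conj, h, h']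
  normForm_map k l a := by
    fin_cases k <;> fin_cases l <;> simp [moufangMap, normForm_mul, normForm_conj, hu]
  map_one k := by
    fin_cases k <;> simp [moufangMap]
  map_mul k l m hkl hlm hkm a b := by
    have hu' : normForm (conj u) = 1 := by rw [normForm_conj, hu]
    have h1 : ∀ c, u * (conj u * c) = c := fun c => by rw [mul_conj_cancel_left, hu, one_smul]
    have h2 : ∀ c, conj u * (u * c) = c := fun c => by rw [conj_mul_cancel_left, hu, one_smul]
    have h3 : ∀ c, c * u * conj u = c := fun c => by rw [mul_conj_cancel_right, hu, one_smul]
    have h4 : ∀ c, c * conj u * u = c := fun c => by rw [conj_mul_cancel_right, hu, one_smul]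
    fin_cases k <;> fin_cases l <;> fin_cases m <;>
      simp [moufangMap, middle_moufang, left_moufang, right_moufang, h1, h2, h3, h4] at hkl hlm hkm ⊢

theorem exists_isEntrywiseAut_real (hF : (∀ a b c : F, a * b * c = a * (b * c)) ∨ n = 3)
    {i j : Fin n} (hij : i ≠ j) (a : F) :
    ∃ φ : Fin n → Fin n → F →ₗ[ℝ] F, IsEntrywiseAut φ ∧ ∃ r : ℝ, φ i j a = r • (1 : F) := by
  rcases hF with hF | rfl
  · obtain ⟨u, hu, r, hr⟩ := exists_mul_conj_eq_smul_one a
    refine ⟨_, isEntrywiseAut_diagConjMap hF (d := fun k => if k = j then u else 1)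
      (fun k => ?_), r, ?_⟩
    · split_ifs
      exacts [hu, normForm_one]
    · simp [diagConjMap_apply, hij, hr]
  · obtain ⟨u, hu, r, hr⟩ := exists_mul_mul_eq_smul_one a
    -- The map at position `(0, 2)` is `a ↦ u * a * u`, the one that the choice of `u` makes real.
    obtain ⟨ρ, hi, hj⟩ : ∃ ρ : Equiv.Perm (Fin 3), ρ i = 0 ∧ ρ j = 2 := by
      revert i j
      decide
    refine ⟨_, (isEntrywiseAut_moufangMap hu).comp_injective ρ.injective, r, ?_⟩
    rw [hi, hj]
    exact hr

/-- An off-diagonal entry can be made real by an automorphism that fixes the diagonal entries and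
preserves the norms of all entries. -/
theorem exists_isTraceAut_real (hF : (∀ a b c : F, a * b * c = a * (b * c)) ∨ n = 3)
    {i j : Fin n} (hij : i ≠ j) (a : F) :
    ∃ g : Herm n F →ₗ[ℝ] Herm n F, IsTraceAut g ∧
      (∀ x k, (g x : Matrix (Fin n) (Fin n) F) k k = (x : Matrix (Fin n) (Fin n) F) k k) ∧
      (∀ x k l, normForm ((g x : Matrix (Fin n) (Fin n) F) k l) =
        normForm ((x : Matrix (Fin n) (Fin n) F) k l)) ∧
      ∀ x : Herm n F, (x : Matrix (Fin n) (Fin n) F) i j = a →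
        ∃ r : ℝ, (g x : Matrix (Fin n) (Fin n) F) i j = r • (1 : F) := by
  obtain ⟨φ, hφ, r, hr⟩ := exists_isEntrywiseAut_real hF hij a
  obtain ⟨g, hg, hgφ⟩ := exists_isTraceAut_entrywise φ hφ.conj_map hφ.normForm_map hφ.map_one
    hφ.map_mul
  refine ⟨g, hg, fun x k => ?_, fun x k l => ?_, fun x hx => ⟨r, ?_⟩⟩
  · rw [hgφ, herm_apply_self_eq x k, map_smul, hφ.map_one]
  · rw [hgφ, hφ.normForm_map]
  · rw [hgφ, hx, hr]

end RealEntry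

/-! ### Maxima on orbits of a compact set of isometries. -/

section Compactness

/-- A compact set of linear isometries defined by the preservation of a bilinear product and of a
linear functional: a sum of squares of linear functionals attains a maximum on each orbit. -/
theorem exists_isMax_sum_sq_orbit_of_norm {V ι : Type*} [NormedAddCommGroup V] [NormedSpace ℝ V]
    [FiniteDimensional ℝ V] [Fintype ι] (m : V →ₗ[ℝ] V →ₗ[ℝ] V) (t : V →ₗ[ℝ] ℝ)
    (S : Set (V →ₗ[ℝ] V))
    (hS : ∀ g, g ∈ S ↔ (∀ x y, g (m x y) = m (g x) (g y)) ∧ ∀ x, t (g x) = t x)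
    (hSh : ∀ g ∈ S, ∀ x, ‖g x‖ = ‖x‖) (ℓ : ι → V →ₗ[ℝ] ℝ) (x : V) :
    ∃ g ∈ S, ∀ g' ∈ S, ∑ i, ℓ i (g' x) ^ 2 ≤ ∑ i, ℓ i (g x) ^ 2 := by
  have : ProperSpace (V →L[ℝ] V) := FiniteDimensional.proper ℝ (V →L[ℝ] V)
  let K : Set (V →L[ℝ] V) := {g | (g : V →ₗ[ℝ] V) ∈ S}
  have hm : Continuous fun p : V × V => m p.1 p.2 := by
    exact m.toContinuousBilinearMap.isBoundedBilinearMap.continuous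
  have heval : ∀ v : V, Continuous fun g : V →L[ℝ] V => g v := fun v => by fun_prop
  have hclosed : IsClosed K := by
    have : K = (⋂ x, ⋂ y, {g : V →L[ℝ] V | g (m x y) = m (g x) (g y)}) ∩
        ⋂ x, {g : V →L[ℝ] V | t (g x) = t x} := by
      ext g
      simp [K, hS]
    rw [this]
    refine (isClosed_iInter fun x => isClosed_iInter fun y => ?_).inter
      (isClosed_iInter fun x => ?_)
    · exact isClosed_eq (heval _) (hm.comp ((heval x).prodMk (heval y)))
    · exact isClosed_eq ((LinearMap.continuous_of_finiteDimensional t).comp (heval x))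
        continuous_const
  have hbdd : Bornology.IsBounded K := by
    refine (Metric.isBounded_closedBall (x := (0 : V →L[ℝ] V)) (r := 1)).subset fun g hg => ?_
    rw [mem_closedBall_zero_iff]
    refine g.opNorm_le_bound zero_le_one fun v => ?_
    rw [one_mul]
    exact (hSh _ hg v).le
  have hcomp : IsCompact K := Metric.isCompact_of_isClosed_isBounded hclosed hbdd
  have hne : K.Nonempty := ⟨ContinuousLinearMap.id ℝ V, (hS _).2 ⟨fun _ _ => rfl, fun _ => rfl⟩⟩
  have hcont : Continuous fun g : V →L[ℝ] V => ∑ i, ℓ i (g x) ^ 2 :=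
    (by fun_prop : Continuous fun v : V => ∑ i, (ℓ i).toContinuousLinearMap v ^ 2).comp (heval x)
  obtain ⟨g, hg, hmax⟩ := hcomp.exists_isMaxOn hne hcont.continuousOn
  refine ⟨g, hg, fun g' hg' => ?_⟩
  exact hmax (a := LinearMap.toContinuousLinearMap g') (by simpa [K] using hg')

/-- The form `h` itself supplies the norm, for which `hSh` says that the maps in `S` are isometries.
The instances are passed explicitly because `V` carries no norm of its own. -/
theorem exists_isMax_sum_sq_orbit {V ι : Type*} [AddCommGroup V] [Module ℝ V]
    [FiniteDimensional ℝ V] [Fintype ι] (m : V →ₗ[ℝ] V →ₗ[ℝ] V) (t : V →ₗ[ℝ] ℝ)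
    (h : LinearMap.BilinForm ℝ V) (hsymm : ∀ x y, h x y = h y x) (hpos : ∀ x, x ≠ 0 → 0 < h x x)
    (S : Set (V →ₗ[ℝ] V))
    (hS : ∀ g, g ∈ S ↔ (∀ x y, g (m x y) = m (g x) (g y)) ∧ ∀ x, t (g x) = t x)
    (hSh : ∀ g ∈ S, ∀ x, h (g x) (g x) = h x x) (ℓ : ι → V →ₗ[ℝ] ℝ) (x : V) :
    ∃ g ∈ S, ∀ g' ∈ S, ∑ i, ℓ i (g' x) ^ 2 ≤ ∑ i, ℓ i (g x) ^ 2 := by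
  let core : InnerProductSpace.Core ℝ V :=
    { inner := fun x y => h x y
      conj_inner_symm := fun x y => hsymm y x
      re_inner_nonneg := fun x => by
        rcases eq_or_ne x 0 with rfl | hx
        · simp
        · exact (hpos x hx).le
      add_left := fun x y z => by simp
      smul_left := fun x y r => by simp
      definite := fun x hx => by
        by_contra h0
        exact (hpos x h0).ne' hx }
  exact @exists_isMax_sum_sq_orbit_of_norm V ι core.toNormedAddCommGroup
    (@InnerProductSpace.toNormedSpace ℝ V _ _ (InnerProductSpace.ofCore core.toCore)) _ _ m t S hS
    (fun g hg x => congrArg Real.sqrt (hSh g hg x)) ℓ x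

end Compactness

/-! ### Diagonalization by Jacobi rotations. -/

section Diagonalization

open RealHurwitzAlgebra

/-- Rotating by half the argument of `a + bi` aligns it with the real axis. -/
theorem exists_half_angle (a b : ℝ) : ∃ c s : ℝ, c ^ 2 + s ^ 2 = 1 ∧
    ((c ^ 2 - s ^ 2) * a + 2 * (c * s) * b) ^ 2 = a ^ 2 + b ^ 2 := by
  set z : ℂ := ⟨a, b⟩ with hz
  refine ⟨Real.cos (z.arg / 2), Real.sin (z.arg / 2), Real.cos_sq_add_sin_sq _, ?_⟩
  have h1 : Real.cos z.arg = Real.cos (z.arg / 2) ^ 2 - Real.sin (z.arg / 2) ^ 2 := by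
    rw [← Real.cos_two_mul', mul_div_cancel₀ _ (two_ne_zero (α := ℝ))]
  have h2 : Real.sin z.arg = 2 * (Real.cos (z.arg / 2) * Real.sin (z.arg / 2)) := by
    rw [← mul_div_cancel₀ z.arg (two_ne_zero (α := ℝ)), Real.sin_two_mul,
      mul_div_cancel₀ _ (two_ne_zero (α := ℝ))]
    ring
  rw [← h1, ← h2]
  have ha : ‖z‖ * Real.cos z.arg = a := Complex.norm_mul_cos_arg z
  have hb : ‖z‖ * Real.sin z.arg = b := Complex.norm_mul_sin_arg z
  have h := Real.cos_sq_add_sin_sq z.arg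
  rw [← ha, ← hb]
  linear_combination (‖z‖ ^ 2 * (Real.cos z.arg ^ 2 + Real.sin z.arg ^ 2)) * h

section Givens

variable {ι : Type*} [DecidableEq ι]

/-- The real rotation by the angle with cosine `c` and sine `s` in the coordinate plane `i, j`. -/
def givens (i j : ι) (c s : ℝ) : Matrix ι ι ℝ := Matrix.of fun k p =>
  if k = i then (if p = i then c else if p = j then s else 0)
  else if k = j then (if p = i then -s else if p = j then c else 0)
  else if k = p then 1 else 0

theorem sum_ite_pair_smul [Fintype ι] {M : Type*} [AddCommGroup M] [Module ℝ M] {i j : ι}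
    (hij : i ≠ j) (a b : ℝ) (f : ι → M) :
    ∑ p, (if p = i then a else if p = j then b else 0) • f p = a • f i + b • f j := by
  rw [Fintype.sum_eq_add i j hij]
  · simp [hij.symm]
  · rintro p ⟨hi, hj⟩
    simp [hi, hj]

theorem givens_orthogonal [Fintype ι] {i j : ι} (hij : i ≠ j) {c s : ℝ} (hcs : c ^ 2 + s ^ 2 = 1)
    (p q : ι) :
    ∑ m, givens i j c s m p * givens i j c s m q = if p = q then 1 else 0 := by
  -- Subtracting the same sum for the identity matrix leaves only the rows `i` and `j`.
  have h : ∑ m, (givens i j c s m p * givens i j c s m q -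
      (if m = p then (1 : ℝ) else 0) * (if m = q then (1 : ℝ) else 0)) = 0 := by
    rw [Fintype.sum_eq_add i j hij]
    · simp only [givens, Matrix.of_apply, hij.symm, if_true, if_false]
      by_cases hpi : p = i <;> by_cases hpj : p = j <;> by_cases hqi : q = i <;>
        by_cases hqj : q = j <;> subst_vars <;> simp_all [eq_comm] <;>
        first | ring1 | linear_combination hcs | linear_combination (-1 : ℝ) * hcs
    · rintro m ⟨hi, hj⟩
      simp [givens, hi, hj]
  rw [Finset.sum_sub_distrib, sub_eq_zero] at h
  rw [h]
  simp [eq_comm]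

end Givens

variable {n : ℕ} {F : Type*} [NonAssocRing F] [Module ℝ F] [RealHurwitzAlgebra F]

variable (F) in
/-- The real number on the `k`-th place of the diagonal of a Hermitian matrix. -/
noncomputable def hermDiagEntry (k : Fin n) : Herm n F →ₗ[ℝ] ℝ :=
  re ∘ₗ Matrix.entryLinearMap ℝ F k k ∘ₗ (Herm n F).subtype

theorem hermDiagEntry_apply (k : Fin n) (x : Herm n F) :
    hermDiagEntry F k x = re ((x : Matrix (Fin n) (Fin n) F) k k) := rfl

theorem herm_apply_self_eq_hermDiagEntry (x : Herm n F) (k : Fin n) :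
    (x : Matrix (Fin n) (Fin n) F) k k = hermDiagEntry F k x • (1 : F) :=
  herm_apply_self_eq x k

/-- A Jacobi rotation increases the sum of squares of the diagonal entries. -/
theorem exists_isTraceAut_sum_sq_lt {i j : Fin n} (hij : i ≠ j) {x : Herm n F} {r : ℝ}
    (hr : r ≠ 0) (hx : (x : Matrix (Fin n) (Fin n) F) i j = r • (1 : F)) :
    ∃ g : Herm n F →ₗ[ℝ] Herm n F, IsTraceAut g ∧
      ∑ k, hermDiagEntry F k x ^ 2 < ∑ k, hermDiagEntry F k (g x) ^ 2 := by
  set α := hermDiagEntry F i x with hα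
  set β := hermDiagEntry F j x with hβ
  obtain ⟨c, s, hcs, h⟩ := exists_half_angle (α - β) (2 * r)
  obtain ⟨g, hg, hgx⟩ := exists_isTraceAut_orthogonal (F := F) (givens i j c s)
    (givens_orthogonal hij hcs)
  refine ⟨g, hg, ?_⟩
  have hx' : (x : Matrix (Fin n) (Fin n) F) j i = r • (1 : F) := by
    rw [← herm_conj_apply_apply, hx, conj_smul_one]
  have hi : hermDiagEntry F i (g x) = c ^ 2 * α + 2 * (c * s) * r + s ^ 2 * β := by
    rw [hermDiagEntry_apply, hgx]
    simp only [givens, Matrix.of_apply, if_true, mul_smul, ← Finset.smul_sum,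
      sum_ite_pair_smul hij, hx, hx', herm_apply_self_eq_hermDiagEntry, map_add, map_smul, re_one,
      smul_eq_mul]
    ring
  have hj : hermDiagEntry F j (g x) = s ^ 2 * α - 2 * (c * s) * r + c ^ 2 * β := by
    rw [hermDiagEntry_apply, hgx]
    simp only [givens, Matrix.of_apply, if_true, if_neg hij.symm, mul_smul, ← Finset.smul_sum,
      sum_ite_pair_smul hij, hx, hx', herm_apply_self_eq_hermDiagEntry, map_add, map_smul, re_one,
      smul_eq_mul]
    ring
  rw [← sub_pos, ← Finset.sum_sub_distrib, Fintype.sum_eq_add i j hij]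
  · rw [hi, hj, ← hα, ← hβ]
    -- The rotation keeps the sum of the two diagonal entries and raises the square of their
    -- difference by `4 * r ^ 2`, hence the sum of squares by `2 * r ^ 2`.
    have hr2 : 0 < r ^ 2 := by positivity
    have hsum : (c ^ 2 * α + 2 * (c * s) * r + s ^ 2 * β) +
        (s ^ 2 * α - 2 * (c * s) * r + c ^ 2 * β) = α + β := by
      linear_combination (α + β) * hcs
    set P := c ^ 2 * α + 2 * (c * s) * r + s ^ 2 * β
    set Q := s ^ 2 * α - 2 * (c * s) * r + c ^ 2 * β
    have hdiff : (P - Q) ^ 2 = (α - β) ^ 2 + (2 * r) ^ 2 := by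
      rw [← h]
      simp only [P, Q]
      ring
    have hsum2 : (P + Q) ^ 2 = (α + β) ^ 2 := by rw [hsum]
    nlinarith
  · rintro k ⟨hki, hkj⟩
    rw [hermDiagEntry_apply k (g x), hgx]
    simp [givens, hki, hkj, hermDiagEntry_apply, ite_smul]

/-- Every Hermitian matrix can be diagonalized by a trace preserving automorphism. -/
theorem exists_isTraceAut_diagonal (hn : 0 < n)
    (hF : (∀ a b c : F, a * b * c = a * (b * c)) ∨ n = 3) (x : Herm n F) :
    ∃ g : Herm n F →ₗ[ℝ] Herm n F, IsTraceAut g ∧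
      ∀ i j, i ≠ j → (g x : Matrix (Fin n) (Fin n) F) i j = 0 := by
  -- The metric is invariant, so maximizing the diagonal part amounts to minimizing the off-diagonal
  -- part.
  obtain ⟨g, hg, hmax⟩ := exists_isMax_sum_sq_orbit (jordanMul n F) (hermTrace n F)
    (hermMetric n F) hermMetric_comm (hermMetric_self_pos hn) {g | IsTraceAut g}
    (fun g => ⟨fun h => ⟨h.1, h.2⟩, fun h => ⟨h.1, h.2⟩⟩) (fun g hg x => hg.map_metric x x)
    (fun k => hermDiagEntry F k) x
  refine ⟨g, hg, fun i j hij => ?_⟩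
  by_contra hne
  obtain ⟨g₁, hg₁, hdiag, hnorm, hreal⟩ :=
    exists_isTraceAut_real hF hij ((g x : Matrix (Fin n) (Fin n) F) i j)
  obtain ⟨r, hr⟩ := hreal _ rfl
  have hr0 : r ≠ 0 := by
    rintro rfl
    have h := hnorm (g x) i j
    rw [hr, zero_smul, map_zero] at h
    exact hne ((normForm_eq_zero_iff _).1 h.symm)
  obtain ⟨g₂, hg₂, hlt⟩ := exists_isTraceAut_sum_sq_lt hij hr0 hr
  have h := hmax (g₂ ∘ₗ g₁ ∘ₗ g) (hg₂.comp (hg₁.comp hg))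
  refine absurd hlt (not_lt.2 (h.trans_eq ?_))
  simp only [hermDiagEntry_apply, hdiag]

end Diagonalization

/-! ### The trace of the multiplication operator, and isometry of all automorphisms. -/

section TraceFormula

open RealHurwitzAlgebra

variable {n : ℕ} {F : Type*} [NonAssocRing F] [Module ℝ F] [RealHurwitzAlgebra F]

theorem herm_ext_of_hermDiagEntry {x y : Herm n F}
    (hdiag : ∀ k, hermDiagEntry F k x = hermDiagEntry F k y)
    (hoff : ∀ k l, k ≠ l →
      (x : Matrix (Fin n) (Fin n) F) k l = (y : Matrix (Fin n) (Fin n) F) k l) : x = y := by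
  ext k l
  rcases eq_or_ne k l with rfl | hkl
  · rw [herm_apply_self_eq_hermDiagEntry, herm_apply_self_eq_hermDiagEntry, hdiag]
  · exact hoff k l hkl

variable (F) in
/-- The diagonal matrix unit `e_ii`. -/
def hermUnit (i : Fin n) : Herm n F :=
  ⟨Matrix.single i i 1, by
    intro k l
    simp only [Matrix.single_apply, apply_ite conj, conj_one, map_zero, and_comm]⟩

theorem coe_hermUnit (i : Fin n) :
    (hermUnit F i : Matrix (Fin n) (Fin n) F) = Matrix.single i i 1 := rfl

theorem hermDiagEntry_hermUnit (i k : Fin n) :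
    hermDiagEntry F k (hermUnit F i) = if i = k then 1 else 0 := by
  simp only [hermDiagEntry_apply, coe_hermUnit, Matrix.single_apply, and_self, apply_ite re,
    re_one, map_zero]

theorem hermUnit_apply_of_ne (i : Fin n) {k l : Fin n} (h : k ≠ l) :
    (hermUnit F i : Matrix (Fin n) (Fin n) F) k l = 0 := by
  rw [coe_hermUnit, Matrix.single_apply, if_neg]
  rintro ⟨rfl, rfl⟩
  exact h rfl

theorem eq_sum_smul_hermUnit {x : Herm n F}
    (hx : ∀ i j, i ≠ j → (x : Matrix (Fin n) (Fin n) F) i j = 0) :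
    x = ∑ k, hermDiagEntry F k x • hermUnit F k := by
  refine herm_ext_of_hermDiagEntry (fun k => ?_) fun k l hkl => ?_
  · simp [hermDiagEntry_hermUnit]
  · rw [hx k l hkl]
    simp [Matrix.sum_apply, hermUnit_apply_of_ne _ hkl]

theorem hermTrace_eq_sum_hermDiagEntry (x : Herm n F) :
    hermTrace n F x = ∑ k, hermDiagEntry F k x := hermTrace_eq_sum x

theorem sum_hermUnit_coe :
    ((∑ k, hermUnit F k : Herm n F) : Matrix (Fin n) (Fin n) F) = 1 := by
  rw [AddSubmonoidClass.coe_finsetSum]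
  simp only [coe_hermUnit]
  ext k l
  simp [Matrix.sum_apply, Matrix.single_apply, Matrix.one_apply, ite_and]

theorem jordanMul_sum_hermUnit :
    jordanMul n F (∑ k, hermUnit F k) = LinearMap.id := by
  ext1 y
  ext1
  rw [coe_jordanMul, sum_hermUnit_coe, Matrix.one_mul, Matrix.mul_one, LinearMap.id_apply,
    ← two_smul ℝ, smul_smul]
  norm_num

variable (n F) in
/-- The trace of the Jordan multiplication operator. -/
noncomputable def traceMul : Herm n F →ₗ[ℝ] ℝ :=
  LinearMap.trace ℝ (Herm n F) ∘ₗ jordanMul n F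

theorem traceMul_apply (x : Herm n F) :
    traceMul n F x = LinearMap.trace ℝ (Herm n F) (jordanMul n F x) := rfl

theorem traceMul_map {g : Herm n F ≃ₗ[ℝ] Herm n F} (hg : IsAlgAut (jordanMul n F) g)
    (x : Herm n F) : traceMul n F (g x) = traceMul n F x := by
  rw [traceMul_apply, traceMul_apply, ← LinearMap.trace_conj' (jordanMul n F x) g]
  congr 1
  ext1 y
  rw [LinearEquiv.conj_apply_apply, hg, LinearEquiv.apply_symm_apply]

theorem traceMul_hermUnit (hn : 0 < n) (i j : Fin n) :
    traceMul n F (hermUnit F i) = traceMul n F (hermUnit F j) := by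
  obtain ⟨g, hg, hgx⟩ := exists_isTraceAut_perm (F := F) (Equiv.swap i j)
  have h : g (hermUnit F j) = hermUnit F i := by
    refine herm_ext_of_hermDiagEntry (fun k => ?_) fun k l hkl => ?_
    · rw [hermDiagEntry_apply, hgx, ← hermDiagEntry_apply, hermDiagEntry_hermUnit,
        hermDiagEntry_hermUnit]
      congr 1
      rw [← Equiv.swap_apply_eq_iff, Equiv.swap_apply_right]
    · rw [hgx, hermUnit_apply_of_ne _ hkl,
        hermUnit_apply_of_ne _ ((Equiv.swap i j).injective.ne hkl)]
  rw [← h, ← hg.toLinearEquiv_apply hn, traceMul_map (hg.isAlgAut_toLinearEquiv hn)]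

/-- Both sides are linear and invariant under trace preserving automorphisms, so diagonalization
reduces to the `e_ii`. Permutations give these a common operator trace, and their sum acts as the
identity, whose trace is the dimension. -/
theorem natCast_mul_traceMul (hn : 0 < n)
    (hF : (∀ a b c : F, a * b * c = a * (b * c)) ∨ n = 3) (x : Herm n F) :
    (n : ℝ) * traceMul n F x = Module.finrank ℝ (Herm n F) * hermTrace n F x := by
  have hunit : ∀ i, (n : ℝ) * traceMul n F (hermUnit F i) = Module.finrank ℝ (Herm n F) := by
    intro i
    have h : traceMul n F (∑ k, hermUnit F k) = Module.finrank ℝ (Herm n F) := by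
      rw [traceMul_apply, jordanMul_sum_hermUnit, LinearMap.trace_id]
    rw [map_sum, Finset.sum_congr rfl fun k _ => traceMul_hermUnit hn k i] at h
    simpa using h
  obtain ⟨g, hg, hgx⟩ := exists_isTraceAut_diagonal hn hF x
  rw [← hg.map_trace, ← traceMul_map (hg.isAlgAut_toLinearEquiv hn), hg.toLinearEquiv_apply,
    hermTrace_eq_sum_hermDiagEntry]
  nth_rewrite 1 [eq_sum_smul_hermUnit hgx]
  rw [map_sum, Finset.mul_sum, Finset.mul_sum]
  refine Finset.sum_congr rfl fun k _ => ?_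
  rw [map_smul, smul_eq_mul, ← hunit k]
  ring

theorem hermMetric_eq_traceMul (hn : 0 < n)
    (hF : (∀ a b c : F, a * b * c = a * (b * c)) ∨ n = 3) (x y : Herm n F) :
    hermMetric n F x y =
      (Module.finrank ℝ (Herm n F) : ℝ)⁻¹ * traceMul n F (jordanMul n F x y) := by
  have hn' : (n : ℝ) ≠ 0 := by positivity
  -- The identity matrix has trace `n ≠ 0`, so the space is not zero.
  have hd : (Module.finrank ℝ (Herm n F) : ℝ) ≠ 0 := by
    intro h
    have h1 : hermTrace n F (∑ k, hermUnit F k) = n := by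
      rw [map_sum]
      simp [hermTrace_eq_sum_hermDiagEntry, hermDiagEntry_hermUnit]
    have h2 : (∑ k, hermUnit F k : Herm n F) = 0 := by
      have := Module.finrank_zero_iff.1 (Nat.cast_eq_zero.1 h)
      exact Subsingleton.elim _ _
    rw [h2, map_zero] at h1
    exact hn' h1.symm
  have h := natCast_mul_traceMul hn hF (jordanMul n F x y)
  rw [hermMetric_eq_hermTrace]
  field_simp
  linarith

/-- The operator trace expresses the metric through the product alone, so preserving the product is
enough. -/
theorem IsAlgAut.map_hermMetric (hn : 0 < n)
    (hF : (∀ a b c : F, a * b * c = a * (b * c)) ∨ n = 3) {g : Herm n F ≃ₗ[ℝ] Herm n F}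
    (hg : IsAlgAut (jordanMul n F) g) (x y : Herm n F) :
    hermMetric n F (g x) (g y) = hermMetric n F x y := by
  rw [hermMetric_eq_traceMul hn hF, hermMetric_eq_traceMul hn hF, ← hg, traceMul_map hg]

end TraceFormula

/-! ### The numerator for diagonal `x`, and the underlying real inequality. -/

section DiagonalSect

open RealHurwitzAlgebra

variable {n : ℕ} {F : Type*} [NonAssocRing F] [Module ℝ F] [RealHurwitzAlgebra F]

theorem jordanMul_apply_of_diagonal {x : Herm n F}
    (hx : ∀ i j, i ≠ j → (x : Matrix (Fin n) (Fin n) F) i j = 0) (y : Herm n F) (i j : Fin n) :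
    (jordanMul n F x y : Matrix (Fin n) (Fin n) F) i j =
      ((hermDiagEntry F i x + hermDiagEntry F j x) / 2) •
        (y : Matrix (Fin n) (Fin n) F) i j := by
  rw [coe_jordanMul, Matrix.smul_apply, Matrix.add_apply, Matrix.mul_apply, Matrix.mul_apply,
    Fintype.sum_eq_single i fun k hk => by rw [hx i k hk.symm, zero_mul],
    Fintype.sum_eq_single j fun k hk => by rw [hx k j hk, mul_zero],
    herm_apply_self_eq_hermDiagEntry, herm_apply_self_eq_hermDiagEntry x j, smul_mul_assoc,
    mul_smul_comm, one_mul, mul_one]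
  module

theorem normForm_herm_apply_self (x : Herm n F) (i : Fin n) :
    normForm ((x : Matrix (Fin n) (Fin n) F) i i) = hermDiagEntry F i x ^ 2 := by
  rw [herm_apply_self_eq_hermDiagEntry, normForm_smul_one]

theorem hermMetric_of_diagonal {x : Herm n F}
    (hx : ∀ i j, i ≠ j → (x : Matrix (Fin n) (Fin n) F) i j = 0) (y : Herm n F) :
    hermMetric n F x y = (n : ℝ)⁻¹ * ∑ i, hermDiagEntry F i x * hermDiagEntry F i y := by
  rw [hermMetric_eq_sum]
  congr 1
  refine Finset.sum_congr rfl fun i _ => ?_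
  rw [Fintype.sum_eq_single i fun k hk => by simp [hx i k hk.symm],
    herm_apply_self_eq_hermDiagEntry, herm_apply_self_eq_hermDiagEntry y, map_smul, map_smul,
    LinearMap.smul_apply, polarBilin_self, normForm_one, smul_eq_mul, smul_eq_mul]
  ring

/-- Multiplication by `x` scales the entry `(i, j)` by the mean of `l i` and `l j`, and
multiplication by `x ⋆ x` by the mean of their squares. The weight is the mean of the squares minus
the square of the mean. -/
theorem sect_num_of_diagonal {x : Herm n F}
    (hx : ∀ i j, i ≠ j → (x : Matrix (Fin n) (Fin n) F) i j = 0) (y : Herm n F) :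
    hermMetric n F (jordanMul n F x x) (jordanMul n F y y) -
        hermMetric n F (jordanMul n F x y) (jordanMul n F y x) =
      (n : ℝ)⁻¹ * ∑ i, ∑ j, (hermDiagEntry F i x - hermDiagEntry F j x) ^ 2 / 4 *
        normForm ((y : Matrix (Fin n) (Fin n) F) i j) := by
  have hxx : ∀ i j, i ≠ j →
      (jordanMul n F x x : Matrix (Fin n) (Fin n) F) i j = 0 := fun i j hij => by
    rw [jordanMul_apply_of_diagonal hx, hx i j hij, smul_zero]
  have hd : ∀ i, hermDiagEntry F i (jordanMul n F x x) = hermDiagEntry F i x ^ 2 := fun i => by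
    rw [hermDiagEntry_apply, jordanMul_apply_of_diagonal hx, map_smul, ← hermDiagEntry_apply,
      smul_eq_mul]
    ring
  rw [← hermMetric_invariant, jordanMul_comm y x, hermMetric_self, hermMetric_eq_sum, ← mul_sub,
    ← Finset.sum_sub_distrib]
  congr 1
  refine Finset.sum_congr rfl fun i _ => ?_
  rw [← Finset.sum_sub_distrib]
  refine Finset.sum_congr rfl fun j _ => ?_
  rw [jordanMul_apply_of_diagonal hxx, jordanMul_apply_of_diagonal hx, hd, hd, map_smul,
    LinearMap.smul_apply, polarBilin_self, normForm_smul, smul_eq_mul]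
  ring

section RealInequality

variable {ι : Type*} [Fintype ι] {l μ : ι → ℝ} {N : ι → ι → ℝ}

theorem sq_sub_mul_le [DecidableEq ι] (hN : ∀ i j, 0 ≤ N i j) (hμ : ∀ i, N i i = μ i ^ 2)
    (i j : ι) : (l i - l j) ^ 2 / 4 * N i j ≤
      (∑ k, l k ^ 2) / 2 * (N i j - if i = j then μ i ^ 2 else 0) := by
  split_ifs with hij
  · subst hij
    rw [hμ]
    simp
  · have h : l i ^ 2 + l j ^ 2 ≤ ∑ k, l k ^ 2 := by
      rw [← Finset.sum_pair (f := fun k => l k ^ 2) hij]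
      exact Finset.sum_le_sum_of_subset_of_nonneg (Finset.subset_univ _)
        fun _ _ _ => sq_nonneg _
    rw [sub_zero]
    exact mul_le_mul_of_nonneg_right (by nlinarith [sq_nonneg (l i + l j)]) (hN i j)

theorem sum_sum_sub_ite [DecidableEq ι] (c : ℝ) :
    ∑ i, ∑ j, c * (N i j - if i = j then μ i ^ 2 else 0) =
      c * (∑ i, ∑ j, N i j - ∑ i, μ i ^ 2) := by
  simp [← Finset.mul_sum, Finset.sum_sub_distrib]

theorem sum_sq_sub_mul_le (hN : ∀ i j, 0 ≤ N i j) (hμ : ∀ i, N i i = μ i ^ 2) :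
    ∑ i, ∑ j, (l i - l j) ^ 2 / 4 * N i j ≤
      ((∑ i, l i ^ 2) * (∑ i, ∑ j, N i j) - (∑ i, l i * μ i) ^ 2) / 2 := by
  classical
  have h := Finset.sum_le_sum fun i (_ : i ∈ Finset.univ) =>
    Finset.sum_le_sum fun j (_ : j ∈ Finset.univ) => sq_sub_mul_le (l := l) hN hμ i j
  rw [sum_sum_sub_ite] at h
  have hcs := Finset.sum_mul_sq_le_sq_mul_sq Finset.univ l μ
  linarith

/-- Equality in total forces equality in Cauchy–Schwarz and in every termwise estimate. Cancelling
`N i j ≠ 0` in the latter leaves `(l i + l j)^2` plus twice the sum of the remaining `l k^2` equal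
to zero. -/
theorem eq_of_sum_sq_sub_mul_eq (hN : ∀ i j, 0 ≤ N i j) (hμ : ∀ i, N i i = μ i ^ 2)
    (h : ∑ i, ∑ j, (l i - l j) ^ 2 / 4 * N i j =
      ((∑ i, l i ^ 2) * (∑ i, ∑ j, N i j) - (∑ i, l i * μ i) ^ 2) / 2) :
    (∑ i, l i ^ 2) * (∑ i, μ i ^ 2) = (∑ i, l i * μ i) ^ 2 ∧
      ∀ i j, i ≠ j → N i j ≠ 0 → l j = -l i ∧ ∀ k, k ≠ i → k ≠ j → l k = 0 := by
  classical
  have hle := fun i j => sq_sub_mul_le (l := l) hN hμ i j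
  have hrow := fun i => Finset.sum_le_sum fun j (_ : j ∈ Finset.univ) => hle i j
  have htot := Finset.sum_le_sum fun i (_ : i ∈ Finset.univ) => hrow i
  have hcs := Finset.sum_mul_sq_le_sq_mul_sq Finset.univ l μ
  have htot' := htot
  rw [sum_sum_sub_ite] at htot'
  refine ⟨by linarith, fun i j hij hNij => ?_⟩
  have heq : ∑ i, ∑ j, (l i - l j) ^ 2 / 4 * N i j =
      ∑ i, ∑ j, (∑ k, l k ^ 2) / 2 * (N i j - if i = j then μ i ^ 2 else 0) := by
    rw [sum_sum_sub_ite]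
    linarith
  have h1 := (Finset.sum_eq_sum_iff_of_le fun i _ => hrow i).1 heq i (Finset.mem_univ _)
  have h2 := (Finset.sum_eq_sum_iff_of_le fun j _ => hle i j).1 h1 j (Finset.mem_univ _)
  rw [if_neg hij, sub_zero] at h2
  have h3 := mul_right_cancel₀ hNij h2
  have hsum : ∑ k, l k ^ 2 = l i ^ 2 + l j ^ 2 + ∑ k ∈ Finset.univ \ {i, j}, l k ^ 2 := by
    rw [← Finset.sum_sdiff (Finset.subset_univ {i, j}), Finset.sum_pair hij, add_comm]
  have hnn : 0 ≤ ∑ k ∈ Finset.univ \ {i, j}, l k ^ 2 := Finset.sum_nonneg fun _ _ => sq_nonneg _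
  have h4 : ∑ k ∈ Finset.univ \ {i, j}, l k ^ 2 = 0 := by
    nlinarith [sq_nonneg (l i + l j)]
  refine ⟨?_, fun k hki hkj => ?_⟩
  · have : (l i + l j) ^ 2 = 0 := by nlinarith
    linarith [pow_eq_zero_iff (two_ne_zero) |>.1 this]
  · rw [Finset.sum_eq_zero_iff_of_nonneg fun _ _ => sq_nonneg _] at h4
    exact pow_eq_zero_iff two_ne_zero |>.1 (h4 k (by simp [hki, hkj]))

end RealInequality

end DiagonalSect

/-! ### The bounds and their equality cases. -/

section SectBounds

open RealHurwitzAlgebra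

variable {n : ℕ} {F : Type*} [NonAssocRing F] [Module ℝ F] [RealHurwitzAlgebra F]

theorem gram_of_diagonal {x : Herm n F}
    (hx : ∀ i j, i ≠ j → (x : Matrix (Fin n) (Fin n) F) i j = 0) (y : Herm n F) :
    hermMetric n F x x * hermMetric n F y y - hermMetric n F x y ^ 2 =
      (n : ℝ)⁻¹ ^ 2 * ((∑ i, hermDiagEntry F i x ^ 2) *
        (∑ i, ∑ j, normForm ((y : Matrix (Fin n) (Fin n) F) i j)) -
          (∑ i, hermDiagEntry F i x * hermDiagEntry F i y) ^ 2) := by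
  rw [hermMetric_of_diagonal hx, hermMetric_of_diagonal hx, hermMetric_self]
  simp only [sq]
  ring

theorem gram_herm_pos (hn : 0 < n) {x y : Herm n F} (hxy : LinearIndependent ℝ ![x, y]) :
    0 < hermMetric n F x x * hermMetric n F y y - hermMetric n F x y ^ 2 :=
  (isMetrizedCommutative_herm hn).gram_pos (hermMetric_self_pos hn) hxy

theorem sect_nonneg_and_le (hn : 0 < n)
    (hF : (∀ a b c : F, a * b * c = a * (b * c)) ∨ n = 3) {x y : Herm n F}
    (hxy : LinearIndependent ℝ ![x, y]) :
    0 ≤ sect (jordanMul n F) (hermMetric n F) x y ∧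
      sect (jordanMul n F) (hermMetric n F) x y ≤ (n : ℝ) / 2 := by
  obtain ⟨g, hg, hgx⟩ := exists_isTraceAut_diagonal hn hF x
  rw [← hg.sect_eq]
  have hpos := gram_herm_pos hn (hg.linearIndependent hn hxy)
  have hn' : (n : ℝ) ≠ 0 := by positivity
  rw [sect, sect_num_of_diagonal hgx]
  constructor
  · refine div_nonneg (mul_nonneg (by positivity) ?_) hpos.le
    exact Finset.sum_nonneg fun i _ => Finset.sum_nonneg fun j _ =>
      mul_nonneg (by positivity) (normForm_nonneg _)
  · rw [div_le_iff₀ hpos, gram_of_diagonal hgx]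
    have h := sum_sq_sub_mul_le (l := fun i => hermDiagEntry F i (g x))
      (fun i j => normForm_nonneg ((g y : Matrix (Fin n) (Fin n) F) i j))
      (normForm_herm_apply_self (g y))
    refine (mul_le_mul_of_nonneg_left h (by positivity)).trans_eq ?_
    field_simp

/-- Needed for the commutator of two Hermitian matrices, which is skew-Hermitian. -/
theorem sum_normForm_of_skew {A : Matrix (Fin n) (Fin n) F} (hA : ∀ i j, conj (A i j) = -A j i) :
    ∑ i, ∑ j, normForm (A i j) = -reTrace n F (A * A) := by
  rw [reTrace_mul, ← Finset.sum_neg_distrib]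
  refine Finset.sum_congr rfl fun i _ => ?_
  rw [← Finset.sum_neg_distrib]
  refine Finset.sum_congr rfl fun j _ => ?_
  rw [← neg_neg (A j i), ← hA, mul_neg, map_neg, neg_neg, mul_conj_self, re_smul_one]

/-- In the associative case the numerator of the sectional nonassociativity is a multiple of the
squared norm of the commutator. -/
theorem sect_num_eq_commutator (hassoc : ∀ a b c : F, a * b * c = a * (b * c)) (x y : Herm n F) :
    hermMetric n F (jordanMul n F x x) (jordanMul n F y y) -
        hermMetric n F (jordanMul n F x y) (jordanMul n F y x) =
      (n : ℝ)⁻¹ / 4 * ∑ i, ∑ j, normForm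
        (((x : Matrix (Fin n) (Fin n) F) * (y : Matrix (Fin n) (Fin n) F) -
          (y : Matrix (Fin n) (Fin n) F) * (x : Matrix (Fin n) (Fin n) F)) i j) := by
  rw [sum_normForm_of_skew, hermMetric_eq_reTrace, hermMetric_eq_reTrace]
  · simp only [coe_jordanMul]
    generalize (x : Matrix (Fin n) (Fin n) F) = X
    generalize (y : Matrix (Fin n) (Fin n) F) = Y
    have hm : ∀ A B C : Matrix (Fin n) (Fin n) F, A * B * C = A * (B * C) := by
      intro A B C
      ext i j
      simp only [Matrix.mul_apply, Finset.sum_mul, Finset.mul_sum, hassoc]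
      rw [Finset.sum_comm]
    have h1 := reTrace_mul_comm (X * (Y * Y)) X
    have h2 := reTrace_mul_comm Y (X * (X * Y))
    have h3 := reTrace_mul_comm Y (X * (Y * X))
    simp only [hm] at h1 h2 h3
    simp only [smul_mul_assoc, mul_smul_comm, map_smul, Matrix.add_mul, Matrix.mul_add, map_add,
      Matrix.sub_mul, Matrix.mul_sub, map_sub, hm, h1, h2, h3, smul_eq_mul]
    ring
  · intro i j
    simp only [Matrix.sub_apply, Matrix.mul_apply, map_sub, map_sum,
      RealHurwitzAlgebra.conj_mul, herm_conj_apply_apply, neg_sub]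

theorem sect_eq_zero_iff_commute (hn : 0 < n) (hassoc : ∀ a b c : F, a * b * c = a * (b * c))
    {x y : Herm n F} (hxy : LinearIndependent ℝ ![x, y]) :
    sect (jordanMul n F) (hermMetric n F) x y = 0 ↔
      (x : Matrix (Fin n) (Fin n) F) * (y : Matrix (Fin n) (Fin n) F) =
        (y : Matrix (Fin n) (Fin n) F) * (x : Matrix (Fin n) (Fin n) F) := by
  have hn' : (n : ℝ)⁻¹ / 4 ≠ 0 := by positivity
  rw [sect, div_eq_zero_iff, or_iff_left (gram_herm_pos hn hxy).ne', sect_num_eq_commutator hassoc,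
    mul_eq_zero, or_iff_right hn', ← sub_eq_zero (a := (x : Matrix (Fin n) (Fin n) F) * _)]
  constructor
  · intro h
    have hrow := (Finset.sum_eq_zero_iff_of_nonneg
      fun i _ => Finset.sum_nonneg fun j _ => normForm_nonneg _).1 h
    ext i j
    have hi := (Finset.sum_eq_zero_iff_of_nonneg fun j _ => normForm_nonneg _).1
      (hrow i (Finset.mem_univ _))
    exact (normForm_eq_zero_iff _).1 (hi j (Finset.mem_univ _))
  · intro h
    rw [h]
    simp

theorem sect_jordanMul_self (hn : 0 < n) (hassoc : ∀ a b c : F, a * b * c = a * (b * c))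
    {x : Herm n F} (hx : LinearIndependent ℝ ![x, jordanMul n F x x]) :
    sect (jordanMul n F) (hermMetric n F) x (jordanMul n F x x) = 0 := by
  rw [sect_eq_zero_iff_commute hn hassoc hx, coe_jordanMul, Matrix.mul_smul, Matrix.smul_mul,
    Matrix.mul_add, Matrix.add_mul]
  have h : (x : Matrix (Fin n) (Fin n) F) * (x * x) = x * x * x := by
    ext i j
    simp only [Matrix.mul_apply, Finset.sum_mul, Finset.mul_sum, hassoc]
    rw [Finset.sum_comm]
  rw [h]

/-! ### The model plane and equality in the upper bound. -/

theorem coe_hermDiff (i j : Fin n) : (hermDiff F i j : Matrix (Fin n) (Fin n) F) =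
    Matrix.single i i 1 - Matrix.single j j 1 := rfl

theorem coe_hermSum (i j : Fin n) : (hermSum F i j : Matrix (Fin n) (Fin n) F) =
    Matrix.single i j 1 + Matrix.single j i 1 := rfl

theorem hermDiff_apply_of_ne (i j : Fin n) {k l : Fin n} (h : k ≠ l) :
    (hermDiff F i j : Matrix (Fin n) (Fin n) F) k l = 0 := by
  have e : hermDiff F i j = hermUnit F i - hermUnit F j := rfl
  rw [e, AddSubgroupClass.coe_sub, Matrix.sub_apply, hermUnit_apply_of_ne _ h,
    hermUnit_apply_of_ne _ h, sub_zero]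

theorem hermDiagEntry_hermDiff (i j k : Fin n) : hermDiagEntry F k (hermDiff F i j) =
    (if i = k then 1 else 0) - if j = k then 1 else 0 := by
  have e : hermDiff F i j = hermUnit F i - hermUnit F j := rfl
  rw [e, map_sub, hermDiagEntry_hermUnit, hermDiagEntry_hermUnit]

theorem hermDiagEntry_hermSum {i j : Fin n} (hij : i ≠ j) (k : Fin n) :
    hermDiagEntry F k (hermSum F i j) = 0 := by
  rw [hermDiagEntry_apply, coe_hermSum, Matrix.add_apply, Matrix.single_apply, Matrix.single_apply,
    if_neg, if_neg, add_zero, map_zero]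
  · rintro ⟨rfl, rfl⟩
    exact hij rfl
  · rintro ⟨rfl, rfl⟩
    exact hij rfl

theorem hermMetric_hermDiff_hermSum {i j : Fin n} (hij : i ≠ j) :
    hermMetric n F (hermDiff F i j) (hermSum F i j) = 0 := by
  rw [hermMetric_of_diagonal fun k l h => hermDiff_apply_of_ne i j h]
  simp [hermDiagEntry_hermSum hij]

theorem sect_hermDiff_hermSum (hn : 0 < n) {i j : Fin n} (hij : i ≠ j) :
    sect (jordanMul n F) (hermMetric n F) (hermDiff F i j) (hermSum F i j) = (n : ℝ) / 2 := by
  have hn' : (n : ℝ) ≠ 0 := by positivity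
  have hdiag := fun k l (h : k ≠ l) => hermDiff_apply_of_ne (F := F) i j h
  have hN : ∀ k l, normForm ((hermSum F i j : Matrix (Fin n) (Fin n) F) k l) =
      (if k = i then if l = j then 1 else 0 else 0) +
        if k = j then if l = i then 1 else 0 else 0 := by
    intro k l
    rw [coe_hermSum, Matrix.add_apply, Matrix.single_apply, Matrix.single_apply]
    by_cases h1 : k = i <;> by_cases h2 : k = j <;> by_cases h3 : l = i <;> by_cases h4 : l = j <;>
      simp_all [eq_comm, normForm_one]
  rw [sect, sect_num_of_diagonal hdiag, gram_of_diagonal hdiag]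
  simp only [hN, hermDiagEntry_hermDiff, hermDiagEntry_hermSum hij]
  simp [mul_add, Finset.sum_add_distrib, hij, hij.symm, sub_sq]
  field_simp
  norm_num

/-- Making `y i j` real fixes every diagonal entry and preserves every zero, so it brings `y` to its
model without disturbing `x`. -/
theorem exists_isTraceAut_canonical_of_apply {i j : Fin n} (hij : i ≠ j)
    (hF : (∀ a b c : F, a * b * c = a * (b * c)) ∨ n = 3) {x y : Herm n F}
    (hx : ∀ k l, k ≠ l → (x : Matrix (Fin n) (Fin n) F) k l = 0)
    (hxj : hermDiagEntry F j x = -hermDiagEntry F i x)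
    (hxk : ∀ k, k ≠ i → k ≠ j → hermDiagEntry F k x = 0)
    (hy : ∀ k l, ¬(k = i ∧ l = j) → ¬(k = j ∧ l = i) →
      (y : Matrix (Fin n) (Fin n) F) k l = 0) :
    ∃ g : Herm n F →ₗ[ℝ] Herm n F, IsTraceAut g ∧ ∃ a b : ℝ,
      g x = a • hermDiff F i j ∧ g y = b • hermSum F i j := by
  obtain ⟨g, hg, hdiag, hnorm, hreal⟩ :=
    exists_isTraceAut_real hF hij ((y : Matrix (Fin n) (Fin n) F) i j)
  obtain ⟨r, hr⟩ := hreal y rfl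
  have hzero : ∀ (z : Herm n F) k l, (z : Matrix (Fin n) (Fin n) F) k l = 0 →
      (g z : Matrix (Fin n) (Fin n) F) k l = 0 := fun z k l h => by
    rw [← normForm_eq_zero_iff, hnorm, h, map_zero]
  refine ⟨g, hg, hermDiagEntry F i x, r, ?_, ?_⟩
  · refine herm_ext_of_hermDiagEntry (fun k => ?_) fun k l hkl => ?_
    · rw [hermDiagEntry_apply, hdiag, ← hermDiagEntry_apply, map_smul, hermDiagEntry_hermDiff]
      rcases eq_or_ne k i with rfl | hki
      · simp [hij.symm]
      rcases eq_or_ne k j with rfl | hkj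
      · simp [hij, hxj]
      · simp [hxk k hki hkj, hki.symm, hkj.symm]
    · rw [hzero x k l (hx k l hkl), Submodule.coe_smul, Matrix.smul_apply,
        hermDiff_apply_of_ne i j hkl, smul_zero]
  · ext k l
    rw [Submodule.coe_smul, Matrix.smul_apply, coe_hermSum, Matrix.add_apply, Matrix.single_apply,
      Matrix.single_apply]
    by_cases h1 : k = i ∧ l = j
    · obtain ⟨rfl, rfl⟩ := h1
      simp [hij.symm, hr]
    by_cases h2 : k = j ∧ l = i
    · obtain ⟨rfl, rfl⟩ := h2
      rw [← herm_conj_apply_apply, hr, conj_smul_one]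
      simp [hij]
    · rw [hzero y k l (hy k l h1 h2), if_neg fun h => h1 ⟨h.1.symm, h.2.symm⟩,
        if_neg fun h => h2 ⟨h.1.symm, h.2.symm⟩, add_zero, smul_zero]

theorem exists_perm_map_pair {ι : Type*} [DecidableEq ι] {i j i' j' : ι} (hij : i ≠ j)
    (hij' : i' ≠ j') : ∃ σ : Equiv.Perm ι, σ i = i' ∧ σ j = j' := by
  refine ⟨(Equiv.swap j (Equiv.swap i i' j')).trans (Equiv.swap i i'), ?_, ?_⟩
  · rw [Equiv.trans_apply, Equiv.swap_apply_of_ne_of_ne hij, Equiv.swap_apply_left]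
    intro h
    have h' := congrArg (Equiv.swap i i') h
    rw [Equiv.swap_apply_left, Equiv.swap_apply_self] at h'
    exact hij' h'
  · rw [Equiv.trans_apply, Equiv.swap_apply_left, Equiv.swap_apply_self]

/-- Orthogonal pairs of maximal sectional nonassociativity have a canonical form. -/
theorem exists_isTraceAut_canonical (hn : 0 < n)
    (hF : (∀ a b c : F, a * b * c = a * (b * c)) ∨ n = 3) {x y : Herm n F}
    (hxy : LinearIndependent ℝ ![x, y])
    (hs : sect (jordanMul n F) (hermMetric n F) x y = (n : ℝ) / 2)
    (h0 : hermMetric n F x y = 0) {i j : Fin n} (hij : 1 < n → i ≠ j) :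
    ∃ g : Herm n F →ₗ[ℝ] Herm n F, IsTraceAut g ∧ ∃ a b : ℝ,
      g x = a • hermDiff F i j ∧ g y = b • hermSum F i j := by
  have hn' : (n : ℝ) ≠ 0 := by positivity
  obtain ⟨g, hg, hgx⟩ := exists_isTraceAut_diagonal hn hF x
  rw [← hg.sect_eq] at hs
  rw [← hg.map_metric, hermMetric_of_diagonal hgx, mul_eq_zero,
    or_iff_right (inv_ne_zero hn')] at h0
  have hpos := gram_herm_pos hn (hg.linearIndependent hn hxy)
  have hL : ∑ k, hermDiagEntry F k (g x) ^ 2 ≠ 0 := by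
    intro h
    rw [gram_of_diagonal hgx, h, h0] at hpos
    simp at hpos
  rw [sect, div_eq_iff hpos.ne', sect_num_of_diagonal hgx] at hs
  have hne : ∑ k, ∑ l, (hermDiagEntry F k (g x) - hermDiagEntry F l (g x)) ^ 2 / 4 *
      normForm ((g y : Matrix (Fin n) (Fin n) F) k l) ≠ 0 := by
    intro h
    rw [h, mul_zero] at hs
    have : 0 < (n : ℝ) / 2 := by positivity
    exact (mul_pos this hpos).ne hs
  rw [gram_of_diagonal hgx] at hs
  have heq : ∑ k, ∑ l, (hermDiagEntry F k (g x) - hermDiagEntry F l (g x)) ^ 2 / 4 *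
      normForm ((g y : Matrix (Fin n) (Fin n) F) k l) =
      ((∑ i, hermDiagEntry F i (g x) ^ 2) *
        (∑ i, ∑ j, normForm ((g y : Matrix (Fin n) (Fin n) F) i j)) -
          (∑ i, hermDiagEntry F i (g x) * hermDiagEntry F i (g y)) ^ 2) / 2 := by
    refine mul_left_cancel₀ (inv_ne_zero hn') (hs.trans ?_)
    field_simp
  obtain ⟨hcs, hoff⟩ := eq_of_sum_sq_sub_mul_eq (l := fun i => hermDiagEntry F i (g x))
    (fun i j => normForm_nonneg ((g y : Matrix (Fin n) (Fin n) F) i j))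
    (normForm_herm_apply_self (g y)) heq
  simp only [h0] at hcs
  -- Equality in Cauchy–Schwarz together with orthogonality makes the diagonal of `g y` vanish.
  rw [zero_pow two_ne_zero, mul_eq_zero, or_iff_right hL,
    Finset.sum_eq_zero_iff_of_nonneg fun _ _ => sq_nonneg _] at hcs
  have hμ : ∀ k, (g y : Matrix (Fin n) (Fin n) F) k k = 0 := fun k => by
    rw [herm_apply_self_eq_hermDiagEntry, pow_eq_zero_iff two_ne_zero |>.1 (hcs k (by simp)),
      zero_smul]
  obtain ⟨p, -, hp⟩ := Finset.exists_ne_zero_of_sum_ne_zero hne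
  obtain ⟨q, -, hq⟩ := Finset.exists_ne_zero_of_sum_ne_zero hp
  have hpq : p ≠ q := by
    rintro rfl
    simp at hq
  obtain ⟨hlq, hl⟩ := hoff p q hpq (right_ne_zero_of_mul hq)
  have hlp : hermDiagEntry F p (g x) ≠ 0 := by
    intro h
    refine hL (Finset.sum_eq_zero fun k _ => ?_)
    rcases eq_or_ne k p with rfl | hkp
    · simp [h]
    rcases eq_or_ne k q with rfl | hkq
    · simp [hlq, h]
    · simp [hl k hkp hkq]
  -- A nonzero entry at `(k, l)` kills the diagonal of `g x` outside `{k, l}`; since it is nonzero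
  -- at `p` and `q`, the two index pairs agree.
  have hy : ∀ k l, ¬(k = p ∧ l = q) → ¬(k = q ∧ l = p) →
      (g y : Matrix (Fin n) (Fin n) F) k l = 0 := by
    intro k l h1 h2
    by_contra hkl
    have hkl' : k ≠ l := by
      rintro rfl
      exact hkl (hμ k)
    obtain ⟨-, hz⟩ := hoff k l hkl' ((normForm_eq_zero_iff _).not.2 hkl)
    have hp' : p = k ∨ p = l := by
      by_contra! h
      exact hlp (hz p h.1 h.2)
    have hq' : q = k ∨ q = l := by
      by_contra! h
      have := hz q h.1 h.2
      simp only [hlq, neg_eq_zero] at this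
      exact hlp this
    grind
  have hij' : i ≠ j := hij (by
    have := p.isLt
    have := q.isLt
    have := Fin.val_ne_of_ne hpq
    omega)
  obtain ⟨σ, hσi, hσj⟩ := exists_perm_map_pair hij' hpq
  obtain ⟨g₁, hg₁, hgσ⟩ := exists_isTraceAut_perm (F := F) σ
  have hσ : ∀ k, hermDiagEntry F k (g₁ (g x)) = hermDiagEntry F (σ k) (g x) := fun k => by
    rw [hermDiagEntry_apply, hgσ, hermDiagEntry_apply]
  have hσp : ∀ k, σ k = p ↔ k = i := fun k => by rw [← hσi, σ.apply_eq_iff_eq]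
  have hσq : ∀ k, σ k = q ↔ k = j := fun k => by rw [← hσj, σ.apply_eq_iff_eq]
  obtain ⟨g₂, hg₂, a, b, ha, hb⟩ := exists_isTraceAut_canonical_of_apply hij' hF
    (x := g₁ (g x)) (y := g₁ (g y))
    (fun k l hkl => by rw [hgσ, hgx _ _ (σ.injective.ne hkl)])
    (by rw [hσ, hσ, hσi, hσj, hlq])
    (fun k hki hkj => by
      rw [hσ]
      exact hl _ ((hσp k).not.2 hki) ((hσq k).not.2 hkj))
    (fun k l h1 h2 => by
      rw [hgσ]
      exact hy _ _ (by rwa [hσp, hσq]) (by rwa [hσp, hσq]))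
  exact ⟨_, hg₂.comp (hg₁.comp hg), a, b, ha, hb⟩

theorem IsAlgAut.sect_eq (hn : 0 < n)
    (hF : (∀ a b c : F, a * b * c = a * (b * c)) ∨ n = 3) {g : Herm n F ≃ₗ[ℝ] Herm n F}
    (hg : IsAlgAut (jordanMul n F) g) (x y : Herm n F) :
    sect (jordanMul n F) (hermMetric n F) (g x) (g y) =
      sect (jordanMul n F) (hermMetric n F) x y :=
  sect_map (g := (g : Herm n F →ₗ[ℝ] Herm n F)) hg (hg.map_hermMetric hn hF) x y

theorem linearIndependent_pair_map {V : Type*} [AddCommGroup V] [Module ℝ V] (g : V ≃ₗ[ℝ] V)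
    {x y : V} (h : LinearIndependent ℝ ![x, y]) : LinearIndependent ℝ ![g x, g y] := by
  rw [LinearIndependent.pair_iff] at h ⊢
  intro s t hst
  refine h s t (g.injective ?_)
  rw [map_add, map_smul, map_smul, hst, map_zero]

/-- If `i = j`, the model `hermDiff` is zero and the span is at most a line. This excludes `n = 1`
in the converses. -/
theorem ne_of_linearIndependent_of_mem_span {i j : Fin n} {x y : Herm n F}
    (h : LinearIndependent ℝ ![x, y])
    (hx : x ∈ Submodule.span ℝ {hermDiff F i j, hermSum F i j})
    (hy : y ∈ Submodule.span ℝ {hermDiff F i j, hermSum F i j}) : i ≠ j := by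
  rintro rfl
  have h0 : hermDiff F i i = 0 := by
    ext1
    rw [coe_hermDiff, sub_self]
    rfl
  rw [h0] at hx hy
  obtain ⟨a, b, rfl⟩ := Submodule.mem_span_pair.1 hx
  obtain ⟨c, d, rfl⟩ := Submodule.mem_span_pair.1 hy
  simp only [smul_zero, zero_add] at h
  rw [LinearIndependent.pair_iff] at h
  have e1 := h d (-b) (by module)
  have e2 := h 1 0 (by simp [neg_eq_zero.1 e1.2])
  exact one_ne_zero e2.1

theorem sect_eq_and_orthogonal_iff (hn : 0 < n)
    (hF : (∀ a b c : F, a * b * c = a * (b * c)) ∨ n = 3) {x y : Herm n F}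
    (hxy : LinearIndependent ℝ ![x, y]) {i j : Fin n} (hij : 1 < n → i ≠ j) :
    (sect (jordanMul n F) (hermMetric n F) x y = (n : ℝ) / 2 ∧ hermMetric n F x y = 0) ↔
      ∃ g : Herm n F ≃ₗ[ℝ] Herm n F, IsAlgAut (jordanMul n F) g ∧
        ∃ a b : ℝ, g x = a • hermDiff F i j ∧ g y = b • hermSum F i j := by
  constructor
  · rintro ⟨hs, h0⟩
    obtain ⟨g, hg, a, b, ha, hb⟩ := exists_isTraceAut_canonical hn hF hxy hs h0 hij
    exact ⟨hg.toLinearEquiv hn, hg.isAlgAut_toLinearEquiv hn, a, b, ha, hb⟩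
  · rintro ⟨g, hg, a, b, ha, hb⟩
    have hgxy := linearIndependent_pair_map g hxy
    have hij' : i ≠ j := ne_of_linearIndependent_of_mem_span hgxy
      (ha ▸ Submodule.smul_mem _ _ (Submodule.subset_span (by simp)))
      (hb ▸ Submodule.smul_mem _ _ (Submodule.subset_span (by simp)))
    have hab : a * b - 0 * 0 ≠ 0 := by
      rw [mul_zero, sub_zero]
      refine mul_ne_zero ?_ ?_
      · rintro rfl
        exact hgxy.ne_zero 0 (by simp [ha])
      · rintro rfl
        exact hgxy.ne_zero 1 (by simp [hb])
    rw [← hg.sect_eq hn hF, ← hg.map_hermMetric hn hF, ha, hb]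
    constructor
    · have h := (isMetrizedCommutative_herm (F := F) hn).sect_smul_add (hermDiff F i j)
        (hermSum F i j) a 0 0 b hab
      rw [zero_smul, zero_smul, add_zero, zero_add] at h
      rw [h, sect_hermDiff_hermSum hn hij']
    · simp [hermMetric_hermDiff_hermSum hij']

theorem sect_eq_iff (hn : 0 < n)
    (hF : (∀ a b c : F, a * b * c = a * (b * c)) ∨ n = 3) {x y : Herm n F}
    (hxy : LinearIndependent ℝ ![x, y]) {i j : Fin n} (hij : 1 < n → i ≠ j) :
    sect (jordanMul n F) (hermMetric n F) x y = (n : ℝ) / 2 ↔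
      ∃ g : Herm n F ≃ₗ[ℝ] Herm n F, IsAlgAut (jordanMul n F) g ∧
        (Submodule.span ℝ {x, y}).map (g : Herm n F →ₗ[ℝ] Herm n F) =
          Submodule.span ℝ {hermDiff F i j, hermSum F i j} := by
  have hspan : ∀ (g : Herm n F ≃ₗ[ℝ] Herm n F) (u v : Herm n F),
      (Submodule.span ℝ {u, v}).map (g : Herm n F →ₗ[ℝ] Herm n F) =
        Submodule.span ℝ {g u, g v} := fun g u v => by
    rw [Submodule.map_span, Set.image_pair]
    rfl
  have H := isMetrizedCommutative_herm (F := F) hn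
  constructor
  · intro hs
    have hx : 0 < hermMetric n F x x := hermMetric_self_pos hn x (hxy.ne_zero 0)
    -- Gram–Schmidt: `y - c • x` is orthogonal to `x`, and this shear of determinant `1` preserves
    -- the plane and `sect`.
    set c := hermMetric n F x y / hermMetric n F x x with hc
    have h0 : hermMetric n F x (y - c • x) = 0 := by
      rw [map_sub, map_smul, smul_eq_mul, hc, div_mul_cancel₀ _ hx.ne', sub_self]
    have hxy' : LinearIndependent ℝ ![x, y - c • x] := by
      rw [LinearIndependent.pair_iff] at hxy ⊢
      intro s t hst
      have h := hxy (s - t * c) t (by rw [← hst]; module)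
      refine ⟨?_, h.2⟩
      have h1 := h.1
      rwa [h.2, zero_mul, sub_zero] at h1
    have hs' : sect (jordanMul n F) (hermMetric n F) x (y - c • x) = (n : ℝ) / 2 := by
      rw [← hs, ← H.sect_smul_add x y 1 0 (-c) 1 (by norm_num)]
      congr 1 <;> module
    obtain ⟨g, hg, a, b, ha, hb⟩ :=
      (sect_eq_and_orthogonal_iff hn hF hxy' hij).1 ⟨hs', h0⟩
    refine ⟨g, hg, ?_⟩
    have hgxy := linearIndependent_pair_map g hxy'
    have ha0 : a ≠ 0 := by
      rintro rfl
      exact hgxy.ne_zero 0 (by simp [ha])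
    have hb0 : b ≠ 0 := by
      rintro rfl
      exact hgxy.ne_zero 1 (by simp [hb])
    have hgy : g y = b • hermSum F i j + (c * a) • hermDiff F i j := by
      rw [← hb, map_sub, map_smul, ha, smul_smul, sub_add_cancel]
    rw [hspan, ha, hgy]
    apply le_antisymm <;> rw [Submodule.span_le, Set.insert_subset_iff, Set.singleton_subset_iff] <;>
      simp only [SetLike.mem_coe, Submodule.mem_span_pair]
    · exact ⟨⟨a, 0, by module⟩, ⟨c * a, b, by module⟩⟩
    · refine ⟨⟨a⁻¹, 0, ?_⟩, ⟨-(b⁻¹ * c), b⁻¹, ?_⟩⟩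
      · rw [zero_smul, add_zero, smul_smul, inv_mul_cancel₀ ha0, one_smul]
      · rw [smul_add, smul_smul b⁻¹ b, inv_mul_cancel₀ hb0]
        module
  · rintro ⟨g, hg, hspan'⟩
    rw [hspan] at hspan'
    have hgxy := linearIndependent_pair_map g hxy
    have hij' : i ≠ j := ne_of_linearIndependent_of_mem_span hgxy
      (hspan' ▸ Submodule.subset_span (by simp)) (hspan' ▸ Submodule.subset_span (by simp))
    rw [← hg.sect_eq hn hF, H.sect_eq_of_span_eq hgxy hspan', sect_hermDiff_hermSum hn hij']

end SectBounds
theorem mainTheorem5 (n : ℕ) (hn : 0 < n)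
    (F : Type*) [NonAssocRing F] [Module ℝ F] [RealHurwitzAlgebra F]
    (hF : (∀ a b c : F, a * b * c = a * (b * c)) ∨ n = 3) :
    -- the two expressions for the metric agree, and it is a positive definite metric
    (∀ x y : Herm n F, hermMetric n F x y =
      (Module.finrank ℝ (Herm n F) : ℝ)⁻¹ *
        LinearMap.trace ℝ (Herm n F) (jordanMul n F (jordanMul n F x y))) ∧
    IsMetrizedCommutative (jordanMul n F) (hermMetric n F) ∧
    (∀ x : Herm n F, x ≠ 0 → 0 < hermMetric n F x x) ∧
    -- the bounds
    (∀ x y : Herm n F, LinearIndependent ℝ ![x, y] →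
      0 ≤ sect (jordanMul n F) (hermMetric n F) x y ∧
      sect (jordanMul n F) (hermMetric n F) x y ≤ (n : ℝ) / 2) ∧
    -- equality in the lower bound
    ((∀ a b c : F, a * b * c = a * (b * c)) →
      (∀ x y : Herm n F, LinearIndependent ℝ ![x, y] →
        (sect (jordanMul n F) (hermMetric n F) x y = 0 ↔
          (x : Matrix (Fin n) (Fin n) F) * (y : Matrix (Fin n) (Fin n) F) =
            (y : Matrix (Fin n) (Fin n) F) * (x : Matrix (Fin n) (Fin n) F))) ∧
      (∀ x : Herm n F, LinearIndependent ℝ ![x, jordanMul n F x x] →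
        sect (jordanMul n F) (hermMetric n F) x (jordanMul n F x x) = 0)) ∧
    -- equality in the upper bound
    (∀ x y : Herm n F, LinearIndependent ℝ ![x, y] →
      (sect (jordanMul n F) (hermMetric n F) x y = (n : ℝ) / 2 ↔
        ∃ g : Herm n F ≃ₗ[ℝ] Herm n F, IsAlgAut (jordanMul n F) g ∧
          (Submodule.span ℝ {x, y}).map (g : Herm n F →ₗ[ℝ] Herm n F) =
            Submodule.span ℝ {hermDiff F ⟨0, hn⟩ ⟨n - 1, Nat.sub_lt hn Nat.one_pos⟩,
              hermSum F ⟨0, hn⟩ ⟨n - 1, Nat.sub_lt hn Nat.one_pos⟩}) ∧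
      ((sect (jordanMul n F) (hermMetric n F) x y = (n : ℝ) / 2 ∧ hermMetric n F x y = 0) ↔
        ∃ g : Herm n F ≃ₗ[ℝ] Herm n F, IsAlgAut (jordanMul n F) g ∧
          ∃ a b : ℝ,
            g x = a • hermDiff F ⟨0, hn⟩ ⟨n - 1, Nat.sub_lt hn Nat.one_pos⟩ ∧
            g y = b • hermSum F ⟨0, hn⟩ ⟨n - 1, Nat.sub_lt hn Nat.one_pos⟩)) := by
  -- For `n = 1` the two corner indices coincide, so distinctness is available only for `1 < n`.
  have hij : 1 < n →
      (⟨0, hn⟩ : Fin n) ≠ ⟨n - 1, Nat.sub_lt hn Nat.one_pos⟩ := by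
    intro h h'
    have := congrArg Fin.val h'
    simp only at this
    omega
  exact ⟨hermMetric_eq_traceMul hn hF, isMetrizedCommutative_herm hn, hermMetric_self_pos hn,
    fun x y hxy => sect_nonneg_and_le hn hF hxy,
    fun hassoc => ⟨fun x y hxy => sect_eq_zero_iff_commute hn hassoc hxy,
      fun x hx => sect_jordanMul_self hn hassoc hx⟩,
    fun x y hxy => ⟨sect_eq_iff hn hF hxy hij, sect_eq_and_orthogonal_iff hn hF hxy hij⟩⟩
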